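/- Let $d\ge 1$ and let $\mathcal S_d=\{x\in\mathbb R^d: x_j\ge 0,\ \sum_j x_j=1\}$. For a $d\times d$ matrix $X$ and $1\le r\le d$ let $T_r(X)$ be the $d\times d$ identity matrix with row $r$ replaced by row $r$ of $X$. Let $X=(X_{i,j})$ be a random $d\times d$ stochastic matrix such that $T_1(X)\cdots T_d(X)$ satisfies the following condition [C2]: if $M(1),M(2),\dots$ are i.i.d. copies of this random matrix, then there is an $m\ge1$ such that, with positive probability, all entries of $M(m)M(m-1)\cdots M(1)$ are positive. Let $(\alpha_{i,j})_{1\le i,j\le d}$ be real numbers such that the cyclic sums $$\beta_{r,j}=\sum_{i=j}^{r}\alpha_{i,j}\ \ (j\le r),\qquad \beta_{r,j}=\sum_{i=j}^{d+r}\alpha_{i,j}\ \ (j>r)$$ (with row indices $i$ read modulo $d$) are all positive. Let $V=(V_{i,j})$ be a random $d\times d$ matrix, independent of $X$, whose entries are independent, $V_{i,j}$ having the Gamma law with density $x^{\beta_{i,j}-1}e^{-x}/\Gamma(\beta_{i,j})$ on $(0,\infty)$. Write $V^{(r)}$ for row $r$ of $V$, put $V^{(0)}:=V^{(d)}$, and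 suppose that $$V^{(r)}\overset{d}{=}V^{(r-1)}T_r(X),\qquad 1\le r\le d.$$ Let $X(0),X(1),\dots$ be random stochastic matrices such that all the rows of all these matrices are independent and row $r$ of each $X(t)$ is distributed as row $r$ of $X$ (if the rows of $X$ are independent, this means that the $X(t)$ are i.i.d. copies of $X$). Define the walk $B(n)\in\mathcal S_d$, $n\ge0$, from a non-random point $B(0)\in\mathcal S_d$ by $$B(td+r)=B(td+r-1)\,T_r(X(t)),\qquad t\ge 0,\ 1\le r\le d,$$ that is, the mass at node $r$ is redistributed according to row $r$ of $X(t)$. Then, for every $r=1,\dots,d$, the sequence $\{B(td+r)\}_{t\ge0}$ is a homogeneous Markov chain, whose transition law from $x\in\mathcal S_d$ is the law of $x\,T_{r+1}(X(0))\cdots T_d(X(0))\,T_1(X(1))\cdots T_r(X(1))$ and hence does not depend on $B(0)$, and the unique stationary probability law on $\mathcal S_d$ of this transition law is the Dirichlet distribution $D_{(\beta_{r,1},\dots,\beta_{r,d})}$, which has density $\Gamma\bigl(\sum_j\beta_{r,j}\bigr)\prod_{j=1}^d x_j^{\beta_{r,j}-1}/\Gamma(\beta_{r,j})$ with respect to $dx_1\cdots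 dx_{d-1}$ on $\mathcal S_d$. -/

import Mathlib

open MeasureTheory ProbabilityTheory
open scoped Matrix ENNReal

namespace PollingNetwork

/-- The sigma-algebra of a space of matrices: the product one, generated by the entries. -/
instance instMeasurableSpaceMatrix {m n : Type*} : MeasurableSpace (Matrix m n ℝ) :=
  inferInstanceAs (MeasurableSpace (m → n → ℝ))

/-- The point `(x₁, …, x_{d-1}, 1 - x₁ - ⋯ - x_{d-1})` of the hyperplane `∑ xᵢ = 1`. -/
def simplexPoint {d : ℕ} (x : Fin (d - 1) → ℝ) : Fin d → ℝ :=
  fun i => if h : (i : ℕ) < d - 1 then x ⟨i, h⟩ else 1 - ∑ k, x k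

/-- The density `Γ(a₁ + ⋯ + a_d) ∏ xᵢ ^ (aᵢ - 1) / Γ(aᵢ)`. -/
noncomputable def dirichletDensity {d : ℕ} (a x : Fin d → ℝ) : ℝ :=
  Real.Gamma (∑ i, a i) * ∏ i, (x i ^ (a i - 1) / Real.Gamma (a i))

/-- The Dirichlet distribution with positive parameters `a`, as a measure on `ℝ^d`: it is carried
by the simplex and has there the density `dirichletDensity a` with respect to
`dx₁ ⋯ dx_{d-1}`. -/
noncomputable def dirichlet {d : ℕ} (a : Fin d → ℝ) : Measure (Fin d → ℝ) :=
  (((volume : Measure (Fin (d - 1) → ℝ)).restrict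
      {x | ∀ i : Fin d, 0 < simplexPoint x i}).withDensity
    fun x => ENNReal.ofReal (dirichletDensity a (simplexPoint x))).map simplexPoint

/-- The law `G_B` of a random matrix with independent entries, the `(i, j)` entry being Gamma
distributed with shape `B i j` and scale `1`. -/
noncomputable def gammaLaw {d : ℕ} (B : Matrix (Fin d) (Fin d) ℝ) :
    Measure (Matrix (Fin d) (Fin d) ℝ) :=
  Measure.pi fun i => Measure.pi fun j => gammaMeasure (B i j) 1

/-- `T_r(X)`: the identity matrix with row `r` replaced by row `r` of `X`. -/
def rowMatrix {d : ℕ} (r : Fin d) (X : Matrix (Fin d) (Fin d) ℝ) : Matrix (Fin d) (Fin d) ℝ :=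
  Matrix.updateRow 1 r (X r)

/-- `T_1(X) ⋯ T_d(X)`. -/
def rowProduct {d : ℕ} (X : Matrix (Fin d) (Fin d) ℝ) : Matrix (Fin d) (Fin d) ℝ :=
  (List.ofFn fun r => rowMatrix r X).prod

/-- For i.i.d. matrices `X(1), X(2), …` of law `ν` there is an `m` such that
`X(m) X(m-1) ⋯ X(1)` has positive entries with positive probability. -/
def EventuallyPositive {d : ℕ} (ν : Measure (Matrix (Fin d) (Fin d) ℝ)) : Prop :=
  ∃ m : ℕ, 0 < m ∧
    0 < Measure.pi (fun _ : Fin m => ν) {Y | ∀ i j, 0 < (List.ofFn Y).reverse.prod i j}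

/-- The cyclic sums `β_{r,j} = ∑_{i=j}^{r} α_{i,j}` for `j ≤ r` and
`β_{r,j} = ∑_{i=j}^{d+r} α_{i,j}` for `j > r`, row indices being read modulo `d`.
(Here all indices start at `0`.) -/
def cyclicSum {d : ℕ} [NeZero d] (A : Matrix (Fin d) (Fin d) ℝ) : Matrix (Fin d) (Fin d) ℝ :=
  fun r j =>
    if j ≤ r then ∑ i ∈ Finset.Icc (j : ℕ) r, A (Fin.ofNat d i) j
    else ∑ i ∈ Finset.Icc (j : ℕ) (d + r), A (Fin.ofNat d i) j

/-- One move at node `r`: the amount at node `r` is redistributed according to row `r` of `X`. -/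
def move {d : ℕ} (r : Fin d) (X : Matrix (Fin d) (Fin d) ℝ) (x : Fin d → ℝ) : Fin d → ℝ :=
  fun j => (if j = r then 0 else x j) + x r * X r j

/-- The position `k` steps after time `s` of the walk that is at `x` at time `s`, when it is driven
by the matrices `X(0), X(1), …`. The move from time `td + i` to time `td + i + 1`, with
`0 ≤ i < d`, is made at the node with (zero-based) number `i` and uses the matrix `X(t)`. -/
def walk {d : ℕ} [NeZero d] (X : ℕ → Matrix (Fin d) (Fin d) ℝ) (s : ℕ) (x : Fin d → ℝ) :
    ℕ → Fin d → ℝ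
  | 0 => x
  | k + 1 => move (Fin.ofNat d (s + k)) (X ((s + k) / d)) (walk X s x k)

theorem measurable_walk {d : ℕ} [NeZero d] (s k : ℕ) :
    Measurable fun p : (Fin d → ℝ) × (ℕ → Matrix (Fin d) (Fin d) ℝ) => walk p.2 s p.1 k := by
  induction k with
  | zero => exact measurable_fst
  | succ k ih =>
    have hX : ∀ (t : ℕ) (i j : Fin d),
        Measurable fun p : (Fin d → ℝ) × (ℕ → Matrix (Fin d) (Fin d) ℝ) => p.2 t i j := by
      intro t i j
      have h1 : Measurable fun p : (Fin d → ℝ) × (ℕ → Matrix (Fin d) (Fin d) ℝ) => p.2 t :=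
        (measurable_pi_apply t).comp measurable_snd
      have h2 : Measurable fun M : Matrix (Fin d) (Fin d) ℝ => M i j :=
        (measurable_pi_apply (X := fun _ : Fin d => ℝ) j).comp
          (measurable_pi_apply (X := fun _ : Fin d => Fin d → ℝ) i)
      exact h2.comp h1
    have hw : ∀ j : Fin d, Measurable
        fun p : (Fin d → ℝ) × (ℕ → Matrix (Fin d) (Fin d) ℝ) => walk p.2 s p.1 k j :=
      fun j => (measurable_pi_apply j).comp ih
    refine measurable_pi_iff.2 fun j => ?_
    simp only [walk, move]
    refine Measurable.add ?_ ((hw _).mul (hX _ _ _))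
    split_ifs
    · exact measurable_const
    · exact hw j

/-- The transition kernel over one period for the walk observed at the times `td + s`: from `x`
one moves to the position at time `s + d` of the walk that is at `x` at time `s`, the driving
sequence `X(0), X(1), …` having the law `Q`. -/
noncomputable def periodKernel {d : ℕ} [NeZero d] (Q : Measure (ℕ → Matrix (Fin d) (Fin d) ℝ))
    (s : ℕ) : Kernel (Fin d → ℝ) (Fin d → ℝ) :=
  (Kernel.id ×ₖ Kernel.const (Fin d → ℝ) Q).map fun p => walk p.2 s p.1 d

theorem periodKernel_apply {d : ℕ} [NeZero d] (Q : Measure (ℕ → Matrix (Fin d) (Fin d) ℝ))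
    [IsProbabilityMeasure Q] (s : ℕ) (x : Fin d → ℝ) :
    periodKernel Q s x = Q.map fun X => walk X s x d := by
  have h := measurable_walk (d := d) s d
  rw [periodKernel, Kernel.map_apply _ h, Kernel.prod_apply, Kernel.id_apply, Kernel.const_apply,
    Measure.dirac_prod, Measure.map_map h measurable_prodMk_left]
  rfl

/-- `Y` is a homogeneous Markov chain with transition kernel `κ`: given `Y 0, …, Y t`, the
conditional law of `Y (t + 1)` is `κ (Y t)`. -/
def IsHomogeneousMarkovChain {Ω E : Type*} [MeasurableSpace Ω] [MeasurableSpace E]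
    (P : Measure Ω) (κ : Kernel E E) (Y : ℕ → Ω → E) : Prop :=
  (∀ t, Measurable (Y t)) ∧
    ∀ (t : ℕ) (s : Set E), MeasurableSet s →
      P⟦Y (t + 1) ⁻¹' s | ⨆ k : Fin (t + 1), MeasurableSpace.comap (Y k) inferInstance⟧
        =ᵐ[P] fun ω => (κ (Y t ω)).real s

/-- `π` is a stationary probability law, on the simplex, of the transition kernel `κ`. -/
def IsStationaryLaw {d : ℕ} (κ : Kernel (Fin d → ℝ) (Fin d → ℝ)) (π : Measure (Fin d → ℝ)) :
    Prop :=
  IsProbabilityMeasure π ∧ π (stdSimplex ℝ (Fin d))ᶜ = 0 ∧ κ.Invariant π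

end PollingNetwork

namespace PollingNetwork

/-! Stationarity. A move with a stochastic row preserves the total mass, so it commutes with
dividing a vector by its total (`normalize_redistribute`). Normalizing a row of independent Gamma
variables gives a Dirichlet vector (`map_normalize_pi_gammaMeasure`), so the identity in law between
consecutive rows of `V` becomes: the move at node `r` carries the Dirichlet law of row `r - 1` to
that of row `r` (`bind_stepKernel_dirichlet`). After `d` moves the cycle closes.

Markov property. The row used at each time is independent of all rows used before, so the walk has
the composed one-move kernels as transition laws (`setLIntegral_walk_add`).

Uniqueness. Two walks driven by the same rows never move apart in `ℓ¹`, and they come strictly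
closer when the product of the moves has entries bounded below. The rows of `X` may be dependent
while the driving rows are independent, so [C2] is transferred through supports: it yields rows in
the supports of the row laws with a positive product, positivity is an open condition, and
independent rows come close to these with positive probability (`EventuallyPositive.exists_support`,
`exists_pos_measure_le_stepsMatrix`). The kernel of several periods thus contracts Lipschitz
constants, which forces stationary laws to have equal characteristic functions
(`IsStationaryLaw.eq_of_contraction`). Other phases reduce to the start of a period
(`IsStationaryLaw.eq_of_phase_zero`). -/

/-! ### Gamma vectors and the Dirichlet law. -/

theorem lintegral_fin_prod {n : ℕ} (f : Fin n → ℝ → ℝ≥0∞) (hf : ∀ i, Measurable (f i)) :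
    ∫⁻ x : Fin n → ℝ, ∏ i, f i (x i) = ∏ i, ∫⁻ y, f i y := by
  induction n with
  | zero => simp [volume_pi]
  | succ n ih =>
    have hm : Measurable fun x : Fin (n + 1) → ℝ => ∏ i, f i (x i) :=
      Finset.measurable_prod _ fun i _ => (hf i).comp (measurable_pi_apply i)
    rw [← ((volume_preserving_piFinSuccAbove (fun _ : Fin (n + 1) => ℝ) 0).symm).lintegral_comp hm,
      Fin.prod_univ_succ, ← ih _ fun i => hf i.succ, Measure.volume_eq_prod,
      ← lintegral_prod_mul (hf 0).aemeasurable
        (Finset.measurable_prod _ fun i _ => (hf i.succ).comp (measurable_pi_apply i)).aemeasurable]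
    refine lintegral_congr fun p => ?_
    rw [Fin.prod_univ_succ]
    simp [MeasurableEquiv.piFinSuccAbove]

theorem pi_withDensity_fin {n : ℕ} (f : Fin n → ℝ → ℝ≥0∞) (hf : ∀ i, Measurable (f i))
    [∀ i, SigmaFinite (volume.withDensity (f i))] :
    Measure.pi (fun i => (volume : Measure ℝ).withDensity (f i)) =
      (volume : Measure (Fin n → ℝ)).withDensity fun x => ∏ i, f i (x i) := by
  refine Measure.pi_eq fun s hs => ?_
  rw [withDensity_apply _ (MeasurableSet.univ_pi hs), ← lintegral_indicator (MeasurableSet.univ_pi hs)]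
  have h := lintegral_fin_prod (fun i => (s i).indicator (f i)) fun i => (hf i).indicator (hs i)
  have h' : ∀ i, volume.withDensity (f i) (s i) = ∫⁻ y, (s i).indicator (f i) y := fun i => by
    rw [withDensity_apply _ (hs i), lintegral_indicator (hs i)]
  rw [Finset.prod_congr rfl fun i _ => h' i, ← h]
  refine lintegral_congr fun x => ?_
  by_cases hx : x ∈ Set.univ.pi s
  · rw [Set.indicator_of_mem hx]
    exact Finset.prod_congr rfl fun i _ => (Set.indicator_of_mem (hx i (Set.mem_univ i)) _).symm
  · rw [Set.indicator_of_notMem hx]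
    simp only [Set.mem_pi, Set.mem_univ, forall_true_left, not_forall] at hx
    obtain ⟨i, hi⟩ := hx
    exact (Finset.prod_eq_zero (Finset.mem_univ i) (Set.indicator_of_notMem hi _)).symm

theorem measurable_simplexPoint {d : ℕ} :
    Measurable (simplexPoint : (Fin (d - 1) → ℝ) → Fin d → ℝ) := by
  refine measurable_pi_iff.2 fun i => ?_
  unfold simplexPoint
  split_ifs <;> fun_prop

theorem measurableSet_simplexPoint_pos (n : ℕ) :
    MeasurableSet {x : Fin n → ℝ | ∀ i, 0 < simplexPoint (d := n + 1) x i} := by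
  have : {x : Fin n → ℝ | ∀ i, 0 < simplexPoint (d := n + 1) x i} =
      simplexPoint (d := n + 1) ⁻¹' (Set.univ.pi fun _ => Set.Ioi 0) := by
    ext x; simp
  rw [this]
  exact measurable_simplexPoint (d := n + 1) (MeasurableSet.univ_pi fun _ => measurableSet_Ioi)

theorem sum_simplexPoint {n : ℕ} (x : Fin n → ℝ) :
    ∑ i, simplexPoint (d := n + 1) x i = 1 := by
  rw [Fin.sum_univ_castSucc]
  simp [simplexPoint]

/-- Integration over `ℝ^(n+1)` by the sum of the coordinates and the point of the simplex. -/
theorem lintegral_eq_lintegral_simplexPoint {n : ℕ} (F : (Fin (n + 1) → ℝ) → ℝ≥0∞)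
    (hF : Measurable F) (h0 : ∀ v, ∑ i, v i ≤ 0 → F v = 0) :
    ∫⁻ v, F v = ∫⁻ s in Set.Ioi (0 : ℝ), ∫⁻ x : Fin n → ℝ,
      ENNReal.ofReal (s ^ n) * F (s • simplexPoint (d := n + 1) x) := by
  let e := (MeasurableEquiv.piFinSuccAbove (fun _ : Fin (n + 1) => ℝ) (Fin.last n)).symm
  have he : ∀ (y : ℝ) (w : Fin n → ℝ), e (y, w) = Fin.snoc w y := by
    intro y w
    simp [e, MeasurableEquiv.piFinSuccAbove]
    rfl
  have hm : Measurable fun p : ℝ × (Fin n → ℝ) => F (e (p.1 - ∑ i, p.2 i, p.2)) :=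
    hF.comp (e.measurable.comp (by fun_prop))
  have hm' : Measurable fun p : ℝ × (Fin n → ℝ) => F (e p) := hF.comp e.measurable
  calc ∫⁻ v, F v = ∫⁻ p : ℝ × (Fin n → ℝ), F (e p) :=
        (((volume_preserving_piFinSuccAbove (fun _ : Fin (n + 1) => ℝ)
          (Fin.last n)).symm).lintegral_comp hF).symm
    _ = ∫⁻ w : Fin n → ℝ, ∫⁻ y : ℝ, F (e (y, w)) := by
        rw [Measure.volume_eq_prod, lintegral_prod_symm _ hm'.aemeasurable]
    -- For fixed `w`, a translation trades the last coordinate for the total `s`.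
    _ = ∫⁻ w : Fin n → ℝ, ∫⁻ s : ℝ, F (e (s - ∑ i, w i, w)) :=
        lintegral_congr fun w =>
          (lintegral_sub_right_eq_self (fun y => F (e (y, w))) (∑ i, w i)).symm
    _ = ∫⁻ s : ℝ, ∫⁻ w : Fin n → ℝ, F (e (s - ∑ i, w i, w)) :=
        lintegral_lintegral_swap (hm.comp measurable_swap).aemeasurable
    _ = ∫⁻ s in Set.Ioi (0 : ℝ), ∫⁻ w : Fin n → ℝ, F (e (s - ∑ i, w i, w)) := by
        rw [← lintegral_indicator measurableSet_Ioi]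
        refine lintegral_congr fun s => ?_
        by_cases hs : s ∈ Set.Ioi (0 : ℝ)
        · rw [Set.indicator_of_mem hs]
        · rw [Set.indicator_of_notMem hs]
          refine lintegral_eq_zero_of_ae_eq_zero (.of_forall fun w => h0 _ ?_)
          rw [he, Fin.sum_univ_castSucc]
          simpa using hs
    _ = _ := by
        refine setLIntegral_congr_fun measurableSet_Ioi fun s (hs : 0 < s) => ?_
        have hms : Measurable fun w : Fin n → ℝ => F (e (s - ∑ i, w i, w)) :=
          hF.comp (e.measurable.comp (by fun_prop))
        have hmap := Measure.map_addHaar_smul (volume : Measure (Fin n → ℝ)) hs.ne'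
        -- The substitution `w = s • x` supplies the Jacobian `s ^ n`.
        have hv : (volume : Measure (Fin n → ℝ)) = ENNReal.ofReal (s ^ n) •
            (volume : Measure (Fin n → ℝ)).map fun x => s • x := by
          rw [hmap, smul_smul, ← ENNReal.ofReal_mul (by positivity), Module.finrank_fin_fun,
            abs_of_pos (by positivity), mul_inv_cancel₀ (by positivity), ENNReal.ofReal_one,
            one_smul]
        have hmc : Measurable fun x : Fin n → ℝ => F (s • simplexPoint (d := n + 1) x) :=
          hF.comp ((measurable_simplexPoint (d := n + 1)).const_smul s)
        rw [lintegral_const_mul _ hmc]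
        conv_lhs => rw [hv]
        rw [lintegral_smul_measure, lintegral_map hms (measurable_const_smul s), smul_eq_mul]
        congr 1
        refine lintegral_congr fun x => ?_
        congr 1
        rw [he]
        ext i
        refine Fin.lastCases ?_ (fun j => ?_) i
        · simp [simplexPoint, ← Finset.mul_sum, mul_sub]
        · simp [simplexPoint]

/-- The vector of the fractions `vⱼ / ∑ vᵢ`. -/
noncomputable def normalize {d : ℕ} (v : Fin d → ℝ) : Fin d → ℝ := fun j => v j / ∑ i, v i

theorem measurable_normalize {d : ℕ} : Measurable (normalize : (Fin d → ℝ) → Fin d → ℝ) := by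
  refine measurable_pi_iff.2 fun i => ?_
  unfold normalize
  fun_prop

/-- For `a = 1` the density does not vanish at `0`. Changing it on this null set makes the product
density vanish as soon as one coordinate is nonpositive. -/
theorem gammaMeasure_eq_withDensity_indicator (a : ℝ) :
    gammaMeasure a 1 = volume.withDensity ((Set.Ioi 0).indicator (gammaPDF a 1)) := by
  refine withDensity_congr_ae ?_
  have h : ∀ᵐ x : ℝ, x ≠ 0 := by simp [ae_iff]
  filter_upwards [h] with x hx
  rcases lt_or_gt_of_ne hx with h | h
  · rw [gammaPDF_of_neg h, Set.indicator_of_notMem (by simpa using h.le)]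
  · rw [Set.indicator_of_mem (by simpa using h)]

theorem lintegral_rpow_mul_exp_neg {a : ℝ} (ha : 0 < a) :
    ∫⁻ s in Set.Ioi (0 : ℝ), ENNReal.ofReal (Real.exp (-s) * s ^ (a - 1)) =
      ENNReal.ofReal (Real.Gamma a) := by
  rw [Real.Gamma_eq_integral ha, ofReal_integral_eq_lintegral_ofReal]
  · exact Real.GammaIntegral_convergent ha
  · refine (ae_restrict_iff' measurableSet_Ioi).2 (.of_forall fun s (hs : 0 < s) => ?_)
    positivity

/-- For independent Gamma variables with a common scale, the fractions of the sum have the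
Dirichlet distribution. -/
theorem map_normalize_pi_gammaMeasure {d : ℕ} [NeZero d] (a : Fin d → ℝ) (ha : ∀ i, 0 < a i) :
    (Measure.pi fun i => gammaMeasure (a i) 1).map normalize = dirichlet a := by
  obtain ⟨n, rfl⟩ : ∃ n, d = n + 1 := Nat.exists_eq_succ_of_ne_zero (NeZero.ne d)
  have hprob : ∀ i, IsProbabilityMeasure (gammaMeasure (a i) 1) :=
    fun i => isProbabilityMeasure_gammaMeasure (ha i) one_pos
  set h : Fin (n + 1) → ℝ → ℝ≥0∞ := fun i => (Set.Ioi 0).indicator (gammaPDF (a i) 1) with hh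
  have hhm : ∀ i, Measurable (h i) := fun i =>
    ((measurable_gammaPDFReal _ _).ennreal_ofReal).indicator measurableSet_Ioi
  have hpi : (Measure.pi fun i => gammaMeasure (a i) 1) =
      (volume : Measure (Fin (n + 1) → ℝ)).withDensity fun v => ∏ i, h i (v i) := by
    have hsf : ∀ i, SigmaFinite (volume.withDensity (h i)) := fun i => by
      rw [hh, ← gammaMeasure_eq_withDensity_indicator]; infer_instance
    rw [← pi_withDensity_fin h hhm]
    congr 1
    ext1 i
    exact gammaMeasure_eq_withDensity_indicator _
  have hprodm : Measurable fun v : Fin (n + 1) → ℝ => ∏ i, h i (v i) :=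
    Finset.measurable_prod _ fun i _ => (hhm i).comp (measurable_pi_apply i)
  have hsum : 0 < ∑ i, a i := Finset.sum_pos (fun i _ => ha i) Finset.univ_nonempty
  have hS := measurableSet_simplexPoint_pos n
  have hdm : Measurable fun x : Fin n → ℝ =>
      ENNReal.ofReal (dirichletDensity a (simplexPoint (d := n + 1) x)) := by
    have : ∀ i, Measurable fun x : Fin n → ℝ => simplexPoint (d := n + 1) x i :=
      fun i => (measurable_pi_apply i).comp (measurable_simplexPoint (d := n + 1))
    unfold dirichletDensity
    fun_prop
  refine Measure.ext_of_lintegral _ fun g hg => ?_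
  have hgn : Measurable fun v : Fin (n + 1) → ℝ => g (normalize v) := hg.comp measurable_normalize
  have hgs : Measurable fun x : Fin n → ℝ => g (simplexPoint (d := n + 1) x) :=
    hg.comp (measurable_simplexPoint (d := n + 1))
  rw [lintegral_map hg measurable_normalize, hpi,
    lintegral_withDensity_eq_lintegral_mul _ hprodm hgn, dirichlet,
    lintegral_map hg (measurable_simplexPoint (d := n + 1))]
  refine Eq.trans ?_ (lintegral_withDensity_eq_lintegral_mul (volume.restrict
    {x : Fin n → ℝ | ∀ i, 0 < simplexPoint (d := n + 1) x i}) hdm hgs).symm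
  have hzero : ∀ v : Fin (n + 1) → ℝ, (∃ i, v i ≤ 0) → ∏ i, h i (v i) = 0 := by
    rintro v ⟨i, hi⟩
    exact Finset.prod_eq_zero (Finset.mem_univ i) (Set.indicator_of_notMem (by simpa using hi) _)
  rw [lintegral_eq_lintegral_simplexPoint _ (hprodm.mul hgn)]
  swap
  · intro v hv
    have : ∃ i, v i ≤ 0 := by
      by_contra! hc
      exact absurd (Finset.sum_pos (fun i _ => hc i) Finset.univ_nonempty) (not_lt.2 hv)
    simp [hzero v this]
  -- The product density at `s • p` splits into a function of `s` and a function of `p`; the first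
  -- integrates to `Γ(∑ aᵢ)`, the constant of the Dirichlet density.
  have key : ∀ s ∈ Set.Ioi (0 : ℝ), ∫⁻ x : Fin n → ℝ, ENNReal.ofReal (s ^ n) *
        ((fun v : Fin (n + 1) → ℝ => ∏ i, h i (v i)) * fun v => g (normalize v))
          (s • simplexPoint (d := n + 1) x) =
      ENNReal.ofReal (Real.exp (-s) * s ^ (∑ i, a i - 1)) *
        ∫⁻ x in {x : Fin n → ℝ | ∀ i, 0 < simplexPoint (d := n + 1) x i},
          ENNReal.ofReal (∏ i, (simplexPoint (d := n + 1) x i ^ (a i - 1) / Real.Gamma (a i))) *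
            g (simplexPoint (d := n + 1) x) := by
    intro s (hs : 0 < s)
    rw [← lintegral_const_mul' _ _ ENNReal.ofReal_ne_top, ← lintegral_indicator hS]
    refine lintegral_congr fun x => ?_
    simp only [Pi.mul_apply]
    by_cases hx : x ∈ {x : Fin n → ℝ | ∀ i, 0 < simplexPoint (d := n + 1) x i}
    · rw [Set.indicator_of_mem hx]
      change ∀ i, _ at hx
      set p := simplexPoint (d := n + 1) x
      have hnorm : normalize (s • p) = p := by
        ext i
        have h1 : ∑ i, p i = 1 := sum_simplexPoint x
        simp only [normalize, Pi.smul_apply, smul_eq_mul, ← Finset.mul_sum, h1]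
        field_simp
      rw [hnorm, ← mul_assoc, ← mul_assoc]
      congr 1
      have h2 : ∀ i, h i ((s • p) i) = ENNReal.ofReal
          (s ^ (a i - 1) * (Real.exp (-(s * p i)) * (p i ^ (a i - 1) / Real.Gamma (a i)))) := by
        intro i
        have hsp : 0 < s * p i := mul_pos hs (hx i)
        simp only [hh, Pi.smul_apply, smul_eq_mul]
        rw [Set.indicator_of_mem (by simpa using hsp), gammaPDF_of_nonneg hsp.le,
          Real.mul_rpow hs.le (hx i).le]
        congr 1
        simp
        ring
      rw [Finset.prod_congr rfl fun i _ => h2 i, ← ENNReal.ofReal_prod_of_nonneg,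
        ← ENNReal.ofReal_mul (by positivity), ← ENNReal.ofReal_mul (by positivity)]
      · congr 1
        rw [Finset.prod_mul_distrib, Finset.prod_mul_distrib, ← Real.exp_sum,
          Finset.sum_neg_distrib, ← Finset.mul_sum, sum_simplexPoint x,
          ← Real.rpow_sum_of_pos hs, Finset.sum_sub_distrib]
        have : s ^ (∑ i, a i - 1) = s ^ n * s ^ (∑ i, a i - ∑ _i : Fin (n + 1), (1 : ℝ)) := by
          rw [← Real.rpow_natCast, ← Real.rpow_add hs]
          congr 1
          simp only [Finset.sum_const, Finset.card_univ, Fintype.card_fin, nsmul_eq_mul]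
          push_cast
          ring
        rw [this]
        ring_nf
      · intro i _
        have := (hx i).le
        have := Real.Gamma_pos_of_pos (ha i)
        positivity
    · rw [Set.indicator_of_notMem hx]
      simp only [Set.mem_ofPred_eq, not_forall, not_lt] at hx
      obtain ⟨i, hi⟩ := hx
      rw [hzero _ ⟨i, mul_nonpos_of_nonneg_of_nonpos hs.le hi⟩]
      simp
  rw [setLIntegral_congr_fun measurableSet_Ioi key, lintegral_mul_const _ (by fun_prop),
    lintegral_rpow_mul_exp_neg hsum, ← lintegral_const_mul']
  swap
  · exact ENNReal.ofReal_ne_top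
  refine lintegral_congr fun x => ?_
  rw [← mul_assoc, ← ENNReal.ofReal_mul (Real.Gamma_pos_of_pos hsum).le]
  rfl

/-! ### Transition kernels of the moves. -/

/-- The amount at node `i` is redistributed according to `row`. -/
def redistribute {d : ℕ} (i : Fin d) (row x : Fin d → ℝ) : Fin d → ℝ :=
  fun j => (if j = i then 0 else x j) + x i * row j

theorem measurable_redistribute {d : ℕ} (i : Fin d) :
    Measurable fun p : (Fin d → ℝ) × (Fin d → ℝ) => redistribute i p.2 p.1 := by
  refine measurable_pi_iff.2 fun j => ?_
  unfold redistribute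
  split_ifs <;> fun_prop

theorem walk_succ {d : ℕ} [NeZero d] (X : ℕ → Matrix (Fin d) (Fin d) ℝ) (s : ℕ) (x : Fin d → ℝ)
    (k : ℕ) : walk X s x (k + 1) =
      redistribute (Fin.ofNat d (s + k)) (X ((s + k) / d) (Fin.ofNat d (s + k))) (walk X s x k) :=
  rfl

section Kernels

variable {d : ℕ}

/-- The transition kernel of one move at node `i`, the row used having the law `ρ i`. -/
noncomputable def stepKernel (ρ : Fin d → Measure (Fin d → ℝ)) (i : Fin d) :
    Kernel (Fin d → ℝ) (Fin d → ℝ) :=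
  (Kernel.id ×ₖ Kernel.const (Fin d → ℝ) (ρ i)).map fun p => redistribute i p.2 p.1

instance (ρ : Fin d → Measure (Fin d → ℝ)) [∀ i, IsProbabilityMeasure (ρ i)] (i : Fin d) :
    IsMarkovKernel (stepKernel ρ i) :=
  Kernel.IsMarkovKernel.map _ (measurable_redistribute i)

theorem stepKernel_apply (ρ : Fin d → Measure (Fin d → ℝ)) [∀ i, IsProbabilityMeasure (ρ i)]
    (i : Fin d) (x : Fin d → ℝ) :
    stepKernel ρ i x = (ρ i).map fun row => redistribute i row x := by
  have h := measurable_redistribute i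
  rw [stepKernel, Kernel.map_apply _ h, Kernel.prod_apply, Kernel.id_apply, Kernel.const_apply,
    Measure.dirac_prod, Measure.map_map h measurable_prodMk_left]
  rfl

theorem lintegral_stepKernel (ρ : Fin d → Measure (Fin d → ℝ)) [∀ i, IsProbabilityMeasure (ρ i)]
    (i : Fin d) (x : Fin d → ℝ) {f : (Fin d → ℝ) → ℝ≥0∞} (hf : Measurable f) :
    ∫⁻ y, f y ∂stepKernel ρ i x = ∫⁻ row, f (redistribute i row x) ∂ρ i := by
  rw [stepKernel_apply, lintegral_map hf]
  exact (measurable_redistribute i).comp measurable_prodMk_left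

variable [NeZero d]

/-- The transition kernel of the `k` moves from time `s` to time `s + k`. -/
noncomputable def stepsKernel (ρ : Fin d → Measure (Fin d → ℝ)) (s : ℕ) :
    ℕ → Kernel (Fin d → ℝ) (Fin d → ℝ)
  | 0 => Kernel.id
  | k + 1 => stepKernel ρ (Fin.ofNat d (s + k)) ∘ₖ stepsKernel ρ s k

instance (ρ : Fin d → Measure (Fin d → ℝ)) [∀ i, IsProbabilityMeasure (ρ i)] (s k : ℕ) :
    IsMarkovKernel (stepsKernel ρ s k) := by
  induction k with
  | zero => unfold stepsKernel; infer_instance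
  | succ k ih => unfold stepsKernel; infer_instance

theorem stepsKernel_add (ρ : Fin d → Measure (Fin d → ℝ)) (s k l : ℕ) :
    stepsKernel ρ s (k + l) = stepsKernel ρ (s + k) l ∘ₖ stepsKernel ρ s k := by
  induction l with
  | zero => simp [stepsKernel]
  | succ l ih => rw [← add_assoc, stepsKernel, stepsKernel, ih, Kernel.comp_assoc, add_assoc]

/-- The moves are periodic in law with period `d`; this makes the observed chain homogeneous. -/
theorem stepsKernel_add_mul (ρ : Fin d → Measure (Fin d → ℝ)) (t s k : ℕ) :
    stepsKernel ρ (t * d + s) k = stepsKernel ρ s k := by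
  induction k with
  | zero => rfl
  | succ k ih =>
    have : Fin.ofNat d (t * d + s + k) = Fin.ofNat d (s + k) := by
      ext
      simp [add_assoc]
    rw [stepsKernel, stepsKernel, ih, this]

end Kernels

/-! ### Law and Markov property of the driven walk. -/

/-- The indicator of `A` and `W` form one `m`-measurable variable, which is independent of `R`;
Tonelli for the product law then integrates `R` out. -/
theorem setLIntegral_of_indep {Ω E F : Type*} [MeasurableSpace E] [MeasurableSpace F]
    {m mΩ : MeasurableSpace Ω} {P : Measure Ω} [IsProbabilityMeasure P]
    (hm : m ≤ mΩ) {W : Ω → E} {R : Ω → F} (hW : Measurable[m] W) (hR : Measurable R)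
    (hi : Indep m (MeasurableSpace.comap R inferInstance) P) {A : Set Ω} (hA : MeasurableSet[m] A)
    {g : E × F → ℝ≥0∞} (hg : Measurable g) :
    ∫⁻ ω in A, g (W ω, R ω) ∂P = ∫⁻ ω in A, ∫⁻ r, g (W ω, r) ∂(P.map R) ∂P := by
  let Z : Ω → ℝ≥0∞ × E := fun ω => (A.indicator 1 ω, W ω)
  have h1m : Measurable[m] (A.indicator (1 : Ω → ℝ≥0∞)) :=
    Measurable.indicator (@measurable_const _ _ _ m 1) hA
  have hZm : Measurable[m] Z := h1m.prodMk hW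
  have hZ : Measurable Z := hZm.mono hm le_rfl
  have hZR : IndepFun Z R P := by
    rw [IndepFun_iff_Indep]
    exact indep_of_indep_of_le_left hi hZm.comap_le
  have hprob : IsProbabilityMeasure (P.map R) := Measure.isProbabilityMeasure_map hR.aemeasurable
  have hmap := (indepFun_iff_map_prod_eq_prod_map_map hZ.aemeasurable hR.aemeasurable).1 hZR
  have hG : Measurable fun q : (ℝ≥0∞ × E) × F => q.1.1 * g (q.1.2, q.2) := by fun_prop
  have h1 : ∀ ω, A.indicator (fun ω => g (W ω, R ω)) ω = (Z ω).1 * g ((Z ω).2, R ω) := by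
    intro ω
    by_cases h : ω ∈ A <;> simp [Z, h]
  have h2 : ∀ ω, A.indicator (fun ω => ∫⁻ r, g (W ω, r) ∂(P.map R)) ω =
      ∫⁻ r, (Z ω).1 * g ((Z ω).2, r) ∂(P.map R) := by
    intro ω
    by_cases h : ω ∈ A <;> simp [Z, h]
  rw [← lintegral_indicator (hm _ hA), ← lintegral_indicator (hm _ hA), lintegral_congr h1,
    lintegral_congr h2,
    ← lintegral_map (f := fun z : ℝ≥0∞ × E => ∫⁻ r, z.1 * g (z.2, r) ∂(P.map R))
      hG.lintegral_prod_right' hZ, ← lintegral_prod _ hG.aemeasurable, ← hmap,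
    lintegral_map hG (hZ.prodMk hR)]

section Driven

variable {d : ℕ} {Ω : Type*}

/-- The events determined by the rows used before time `n`. -/
@[reducible]
def past (Xs : ℕ → Ω → Matrix (Fin d) (Fin d) ℝ) (n : ℕ) : MeasurableSpace Ω :=
  ⨆ p ∈ {p : ℕ × Fin d | p.1 * d + p.2 < n},
    MeasurableSpace.comap (fun ω => Xs p.1 ω p.2) inferInstance

theorem past_mono (Xs : ℕ → Ω → Matrix (Fin d) (Fin d) ℝ) : Monotone (past Xs) :=
  fun _ _ h => biSup_mono fun _ hp => lt_of_lt_of_le hp h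

theorem measurable_row [MeasurableSpace Ω] {Xs : ℕ → Ω → Matrix (Fin d) (Fin d) ℝ}
    (hXs : ∀ t, Measurable (Xs t))
    (t : ℕ) (i : Fin d) : Measurable fun ω => Xs t ω i :=
  (measurable_pi_apply (X := fun _ : Fin d => Fin d → ℝ) i).comp (hXs t)

theorem past_le [MeasurableSpace Ω] {Xs : ℕ → Ω → Matrix (Fin d) (Fin d) ℝ}
    (hXs : ∀ t, Measurable (Xs t)) (n : ℕ) :
    past Xs n ≤ ‹MeasurableSpace Ω› :=
  iSup₂_le fun p _ => (measurable_row hXs p.1 p.2).comap_le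

variable [NeZero d]

theorem measurable_past_walk (Xs : ℕ → Ω → Matrix (Fin d) (Fin d) ℝ) (s : ℕ) (x : Fin d → ℝ)
    (k : ℕ) : Measurable[past Xs (s + k)] fun ω => walk (fun n => Xs n ω) s x k := by
  induction k with
  | zero => exact measurable_const
  | succ k ih =>
    have hrow : Measurable[past Xs (s + (k + 1))]
        fun ω => Xs ((s + k) / d) ω (Fin.ofNat d (s + k)) := by
      refine Measurable.mono (comap_measurable _) ?_ le_rfl
      refine le_iSup₂_of_le ((s + k) / d, Fin.ofNat d (s + k)) ?_ le_rfl
      have := Nat.div_add_mod' (s + k) d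
      simp only [Set.mem_ofPred_eq, Fin.val_ofNat]
      omega
    exact (measurable_redistribute (Fin.ofNat d (s + k))).comp
      ((ih.mono (past_mono Xs (by omega)) le_rfl).prodMk hrow)

variable [MeasurableSpace Ω]

/-- Row `(t, i)` is used at time `t * d + i`, so the row used at time `n` has index `(n / d, n mod
d)` and is not among those generating the past. -/
theorem indep_past {P : Measure Ω} {Xs : ℕ → Ω → Matrix (Fin d) (Fin d) ℝ}
    (hXs : ∀ t, Measurable (Xs t))
    (hind : iIndepFun (fun (p : ℕ × Fin d) ω => Xs p.1 ω p.2) P) (n : ℕ) :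
    Indep (past Xs n)
      (MeasurableSpace.comap (fun ω => Xs (n / d) ω (Fin.ofNat d n)) inferInstance) P := by
  have h := indep_iSup_of_disjoint (fun p : ℕ × Fin d => (measurable_row hXs p.1 p.2).comap_le)
    hind (S := {p : ℕ × Fin d | p.1 * d + p.2 < n}) (T := {(n / d, Fin.ofNat d n)}) (by
      rw [Set.disjoint_singleton_right]
      have := Nat.div_add_mod' n d
      simp only [Set.mem_ofPred_eq, Fin.val_ofNat]
      omega)
  simpa [past] using h

variable {P : Measure Ω} [IsProbabilityMeasure P] {Xs : ℕ → Ω → Matrix (Fin d) (Fin d) ℝ}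
  {ρ : Fin d → Measure (Fin d → ℝ)} [∀ i, IsProbabilityMeasure (ρ i)]

/-- The Markov property of the walk. -/
theorem setLIntegral_walk_add (hXs : ∀ t, Measurable (Xs t))
    (hlaw : ∀ t i, P.map (fun ω => Xs t ω i) = ρ i)
    (hind : iIndepFun (fun (p : ℕ × Fin d) ω => Xs p.1 ω p.2) P) (s : ℕ) (x : Fin d → ℝ)
    (k l : ℕ) {A : Set Ω} (hA : MeasurableSet[past Xs (s + k)] A) {f : (Fin d → ℝ) → ℝ≥0∞}
    (hf : Measurable f) :
    ∫⁻ ω in A, f (walk (fun n => Xs n ω) s x (k + l)) ∂P =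
      ∫⁻ ω in A, ∫⁻ y, f y ∂stepsKernel ρ (s + k) l (walk (fun n => Xs n ω) s x k) ∂P := by
  induction l generalizing f with
  | zero => simp [stepsKernel, Kernel.id_apply, lintegral_dirac' _ hf]
  | succ l ih =>
    have h1 := setLIntegral_of_indep (P := P) (past_le hXs (s + (k + l)))
      (measurable_past_walk Xs s x (k + l))
      (measurable_row hXs ((s + (k + l)) / d) (Fin.ofNat d (s + (k + l))))
      (indep_past hXs hind (s + (k + l))) (past_mono Xs (by omega) _ hA)
      (hf.comp (measurable_redistribute (Fin.ofNat d (s + (k + l)))))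
    simp only [Function.comp_apply, hlaw] at h1
    simp_rw [← lintegral_stepKernel ρ (Fin.ofNat d (s + (k + l))) _ hf] at h1
    rw [← add_assoc]
    refine h1.trans ((ih (hf.lintegral_kernel (κ := stepKernel ρ _))).trans ?_)
    refine lintegral_congr fun ω => ?_
    rw [stepsKernel, Kernel.lintegral_comp _ _ _ hf, add_assoc]

/-- The law of the walk after `k` moves. -/
theorem map_walk (hXs : ∀ t, Measurable (Xs t)) (hlaw : ∀ t i, P.map (fun ω => Xs t ω i) = ρ i)
    (hind : iIndepFun (fun (p : ℕ × Fin d) ω => Xs p.1 ω p.2) P) (s : ℕ) (x : Fin d → ℝ) (k : ℕ) :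
    P.map (fun ω => walk (fun n => Xs n ω) s x k) = stepsKernel ρ s k x := by
  refine Measure.ext_of_lintegral _ fun f hf => ?_
  have h := setLIntegral_walk_add hXs hlaw hind s x 0 k MeasurableSet.univ hf
  rw [lintegral_map hf ((measurable_past_walk Xs s x k).mono (past_le hXs _) le_rfl)]
  simpa [walk] using h

/-- Replaces the law of the whole driving sequence by the single row laws, so that moves can be
composed and periodicity used. -/
theorem periodKernel_eq_stepsKernel (hXs : ∀ t, Measurable (Xs t))
    (hlaw : ∀ t i, P.map (fun ω => Xs t ω i) = ρ i)
    (hind : iIndepFun (fun (p : ℕ × Fin d) ω => Xs p.1 ω p.2) P) (s : ℕ) :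
    periodKernel (P.map fun ω t => Xs t ω) s = stepsKernel ρ s d := by
  have hm : Measurable fun ω t => Xs t ω := measurable_pi_iff.2 hXs
  have := Measure.isProbabilityMeasure_map (μ := P) hm.aemeasurable
  ext1 x
  rw [periodKernel_apply, ← map_walk hXs hlaw hind]
  exact Measure.map_map ((measurable_walk s d).comp measurable_prodMk_left) hm

/-- The conditioning σ-algebra `m` is left free because the Markov chain conditions on the observed
positions only, which carry less information than all past rows. -/
theorem condExp_walk {Ω : Type*} {m mΩ : MeasurableSpace Ω} {P : Measure Ω}
    [IsProbabilityMeasure P] {Xs : ℕ → Ω → Matrix (Fin d) (Fin d) ℝ}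
    (hXs : ∀ t, Measurable (Xs t)) (hlaw : ∀ t i, P.map (fun ω => Xs t ω i) = ρ i)
    (hind : iIndepFun (fun (p : ℕ × Fin d) ω => Xs p.1 ω p.2) P) (s : ℕ) (b : Fin d → ℝ) (t : ℕ)
    (hmpast : m ≤ past Xs (0 + (t * d + s)))
    (hYm : Measurable[m] fun ω => walk (fun n => Xs n ω) 0 b (t * d + s))
    {B : Set (Fin d → ℝ)} (hB : MeasurableSet B) :
    P⟦(fun ω => walk (fun n => Xs n ω) 0 b ((t + 1) * d + s)) ⁻¹' B | m⟧ =ᵐ[P]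
      fun ω => (stepsKernel ρ s d (walk (fun n => Xs n ω) 0 b (t * d + s))).real B := by
  have hW : ∀ n, Measurable fun ω => walk (fun n => Xs n ω) 0 b n := fun n =>
    (measurable_past_walk Xs 0 b n).mono (past_le hXs _) le_rfl
  have hm : m ≤ mΩ := hmpast.trans (past_le hXs _)
  have hκ : Measurable fun x => (stepsKernel ρ s d x).real B :=
    (Kernel.measurable_coe _ hB).ennreal_toReal
  have hpre : MeasurableSet ((fun ω => walk (fun n => Xs n ω) 0 b ((t + 1) * d + s)) ⁻¹' B) :=
    hW _ hB
  refine (ae_eq_condExp_of_forall_setIntegral_eq hm ?_ ?_ ?_ ?_).symm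
  · exact (integrable_const (1 : ℝ)).indicator hpre
  · intro A _ _
    refine Integrable.integrableOn (Integrable.of_bound (C := 1)
      (hκ.comp (hW _)).aestronglyMeasurable (.of_forall fun ω => ?_))
    rw [Real.norm_of_nonneg measureReal_nonneg]
    exact measureReal_le_one
  · intro A hA _
    have h := setLIntegral_walk_add hXs hlaw hind 0 b (t * d + s) d (hmpast A hA)
      (f := B.indicator 1) (measurable_one.indicator hB)
    have h1 : ∀ ω, B.indicator (1 : (Fin d → ℝ) → ℝ≥0∞)
          (walk (fun n => Xs n ω) 0 b (t * d + s + d)) =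
        ((fun ω => walk (fun n => Xs n ω) 0 b ((t + 1) * d + s)) ⁻¹' B).indicator 1 ω := by
      intro ω
      rw [show t * d + s + d = (t + 1) * d + s by ring]
      rfl
    have h2 : ∀ ω, ∫⁻ y, B.indicator 1 y
          ∂stepsKernel ρ (0 + (t * d + s)) d (walk (fun n => Xs n ω) 0 b (t * d + s)) =
        ENNReal.ofReal ((stepsKernel ρ s d (walk (fun n => Xs n ω) 0 b (t * d + s))).real B) := by
      intro ω
      rw [lintegral_indicator_one hB, zero_add, stepsKernel_add_mul, ofReal_measureReal]
    rw [lintegral_congr h1, lintegral_congr h2, lintegral_indicator_one hpre] at h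
    rw [integral_eq_lintegral_of_nonneg_ae (.of_forall fun ω => measureReal_nonneg)
      (hκ.comp (hW _)).aestronglyMeasurable, ← h, integral_indicator hpre]
    simp [measureReal_def]
  · exact (hκ.comp hYm).aestronglyMeasurable

theorem isHomogeneousMarkovChain_walk (hXs : ∀ t, Measurable (Xs t))
    (hlaw : ∀ t i, P.map (fun ω => Xs t ω i) = ρ i)
    (hind : iIndepFun (fun (p : ℕ × Fin d) ω => Xs p.1 ω p.2) P) (s : ℕ) (b : Fin d → ℝ) :
    IsHomogeneousMarkovChain P (stepsKernel ρ s d)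
      (fun t ω => walk (fun n => Xs n ω) 0 b (t * d + s)) := by
  refine ⟨fun t => (measurable_past_walk Xs 0 b _).mono (past_le hXs _) le_rfl, fun t B hB => ?_⟩
  refine condExp_walk hXs hlaw hind s b t (iSup_le fun k => Measurable.comap_le ?_) ?_ hB
  · refine (measurable_past_walk Xs 0 b _).mono (past_mono Xs ?_) le_rfl
    have : (k : ℕ) * d ≤ t * d := Nat.mul_le_mul_right d (by omega)
    omega
  · exact (comap_measurable _).mono (le_iSup (fun k : Fin (t + 1) => MeasurableSpace.comap
      (fun ω => walk (fun n => Xs n ω) 0 b ((k : ℕ) * d + s)) inferInstance) (Fin.last t)) le_rfl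

end Driven

/-! ### Moves carry each Dirichlet law to the next. -/

theorem vecMul_rowMatrix {d : ℕ} (r : Fin d) (X : Matrix (Fin d) (Fin d) ℝ) (x : Fin d → ℝ) :
    x ᵥ* rowMatrix r X = redistribute r (X r) x := by
  ext j
  have h : ∀ i, x i * rowMatrix r X i j =
      (if i = r then x r * X r j else 0) + if i = j then (if j = r then 0 else x j) else 0 := by
    intro i
    rw [rowMatrix, Matrix.updateRow_apply, Matrix.one_apply]
    by_cases hi : i = r <;> by_cases hj : i = j <;> simp_all
  simp [Matrix.vecMul, dotProduct, h, Finset.sum_add_distrib, redistribute, add_comm]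

theorem sum_redistribute {d : ℕ} (i : Fin d) {row : Fin d → ℝ} (hrow : ∑ j, row j = 1)
    (v : Fin d → ℝ) : ∑ j, redistribute i row v j = ∑ j, v j := by
  have h : ∀ j, redistribute i row v j = v j - (if j = i then v i else 0) + v i * row j := by
    intro j
    unfold redistribute
    split_ifs with h <;> simp [h]
  simp [h, Finset.sum_add_distrib, ← Finset.mul_sum, hrow]

/-- The move is linear up to the choice of row, and it leaves the denominator unchanged. -/
theorem normalize_redistribute {d : ℕ} (i : Fin d) {row : Fin d → ℝ} (hrow : ∑ j, row j = 1)
    (v : Fin d → ℝ) : normalize (redistribute i row v) = redistribute i row (normalize v) := by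
  ext j
  rw [normalize, sum_redistribute i hrow]
  unfold redistribute normalize
  split_ifs <;> ring

theorem isProbabilityMeasure_dirichlet {d : ℕ} [NeZero d] {a : Fin d → ℝ} (ha : ∀ i, 0 < a i) :
    IsProbabilityMeasure (dirichlet a) := by
  have : ∀ i, IsProbabilityMeasure (gammaMeasure (a i) 1) :=
    fun i => isProbabilityMeasure_gammaMeasure (ha i) one_pos
  rw [← map_normalize_pi_gammaMeasure a ha]
  exact Measure.isProbabilityMeasure_map measurable_normalize.aemeasurable

theorem measurableSet_stdSimplex {d : ℕ} : MeasurableSet (stdSimplex ℝ (Fin d)) :=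
  (isClosed_stdSimplex ℝ (Fin d)).measurableSet

theorem dirichlet_compl_stdSimplex {d : ℕ} [NeZero d] (a : Fin d → ℝ) :
    dirichlet a (stdSimplex ℝ (Fin d))ᶜ = 0 := by
  obtain ⟨n, rfl⟩ : ∃ n, d = n + 1 := Nat.exists_eq_succ_of_ne_zero (NeZero.ne d)
  rw [dirichlet, Measure.map_apply measurable_simplexPoint measurableSet_stdSimplex.compl]
  refine withDensity_absolutelyContinuous _ _ ?_
  have h : ∀ᵐ x ∂(volume : Measure (Fin n → ℝ)).restrict
      {x | ∀ i, 0 < simplexPoint (d := n + 1) x i},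
      simplexPoint (d := n + 1) x ∈ stdSimplex ℝ (Fin (n + 1)) :=
    (ae_restrict_iff' (measurableSet_simplexPoint_pos n)).2 (.of_forall fun x hx => ⟨fun i => (hx i).le, sum_simplexPoint x⟩)
  exact h

theorem map_row_gammaLaw {d : ℕ} {Ω : Type*} [MeasurableSpace Ω] {μ : Measure Ω}
    {V : Ω → Matrix (Fin d) (Fin d) ℝ} {β : Matrix (Fin d) (Fin d) ℝ} (hβ : ∀ r j, 0 < β r j) (hVm : Measurable V)
    (hV : μ.map V = gammaLaw β) (r : Fin d) :
    μ.map (fun ω => V ω r) = Measure.pi fun j => gammaMeasure (β r j) 1 := by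
  have h1 : ∀ i j, IsProbabilityMeasure (gammaMeasure (β i j) 1) :=
    fun i j => isProbabilityMeasure_gammaMeasure (hβ i j) one_pos
  have h := (measurePreserving_eval
    (fun i => Measure.pi fun j => gammaMeasure (β i j) 1) r).map_eq
  have h2 : gammaLaw β = Measure.pi fun i => Measure.pi fun j => gammaMeasure (β i j) 1 := rfl
  rw [← h, ← h2, ← hV]
  exact (Measure.map_map (measurable_pi_apply (X := fun _ : Fin d => Fin d → ℝ) r) hVm).symm

section Invariance

variable {d : ℕ} [NeZero d] {Ω : Type*} [MeasurableSpace Ω] {μ : Measure Ω}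
  [IsProbabilityMeasure μ] {X V : Ω → Matrix (Fin d) (Fin d) ℝ} {β : Matrix (Fin d) (Fin d) ℝ}

/-- Both Dirichlet laws are laws of normalized rows of `V`. Since row `r` of `X` is independent of
row `r - 1` of `V`, the left side is the law of the normalized row `r - 1` after a move with that
row; by `normalize_redistribute` and the identity in law for `V` it is the law of the normalized row
`r`. -/
theorem bind_stepKernel_dirichlet (hXm : Measurable X) (hVm : Measurable V)
    (hX : ∀ᵐ ω ∂μ, X ω ∈ Matrix.rowStochastic ℝ (Fin d)) (hβ : ∀ r j, 0 < β r j)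
    (hV : μ.map V = gammaLaw β) (hVX : IndepFun V X μ)
    (hVT : ∀ r : Fin d, IdentDistrib (fun ω => V ω r)
      (fun ω => V ω (r - 1) ᵥ* rowMatrix r (X ω)) μ μ) (r : Fin d) :
    (dirichlet (β (r - 1))).bind (stepKernel (fun i => μ.map fun ω => X ω i) r) =
      dirichlet (β r) := by
  have hrow : ∀ i, Measurable fun M : Matrix (Fin d) (Fin d) ℝ => M i :=
    fun i => measurable_pi_apply (X := fun _ : Fin d => Fin d → ℝ) i
  have hρ : ∀ i, IsProbabilityMeasure (μ.map fun ω => X ω i) :=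
    fun i => Measure.isProbabilityMeasure_map ((hrow i).comp hXm).aemeasurable
  have hD : ∀ i, dirichlet (β i) = μ.map fun ω => normalize (V ω i) := by
    intro i
    rw [← map_normalize_pi_gammaMeasure _ (hβ i), ← map_row_gammaLaw hβ hVm hV i]
    exact Measure.map_map measurable_normalize ((hrow i).comp hVm)
  have hN : Measurable fun ω => normalize (V ω (r - 1)) :=
    measurable_normalize.comp ((hrow _).comp hVm)
  have hXr : Measurable fun ω => X ω r := (hrow r).comp hXm
  have hind : IndepFun (fun ω => normalize (V ω (r - 1))) (fun ω => X ω r) μ :=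
    hVX.comp (measurable_normalize.comp (hrow (r - 1))) (hrow r)
  have hmap := (indepFun_iff_map_prod_eq_prod_map_map hN.aemeasurable hXr.aemeasurable).1 hind
  have hred := measurable_redistribute r
  refine Measure.ext_of_lintegral _ fun f hf => ?_
  rw [Measure.lintegral_bind (Kernel.aemeasurable _) hf.aemeasurable]
  simp_rw [fun x => lintegral_stepKernel (fun i => μ.map fun ω => X ω i) r x hf]
  have hcomp := (hVT r).comp measurable_normalize
  have hfm : Measurable fun p : (Fin d → ℝ) × (Fin d → ℝ) => f (redistribute r p.2 p.1) :=
    hf.comp hred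
  rw [hD (r - 1), ← lintegral_prod _ hfm.aemeasurable, ← hmap, lintegral_map hfm (hN.prodMk hXr),
    hD r, show (μ.map fun ω => normalize (V ω r)) = _ from hcomp.map_eq,
    lintegral_map' hf.aemeasurable hcomp.aemeasurable_snd]
  refine lintegral_congr_ae ?_
  filter_upwards [hX] with ω hω
  rw [Function.comp_apply, vecMul_rowMatrix, normalize_redistribute]
  simpa [Matrix.mulVec, dotProduct] using congrFun hω.2 r

end Invariance

theorem ofNat_succ_sub_one {d : ℕ} [NeZero d] (n : ℕ) :
    Fin.ofNat d (n + 1) - 1 = Fin.ofNat d n := by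
  rw [sub_eq_iff_eq_add]
  ext
  simp [Fin.val_add]

/-- The law indexed by `r` is the one just after the move at node `r`, hence the starting time `r +
1`. -/
theorem bind_stepsKernel {d : ℕ} [NeZero d] {ρ : Fin d → Measure (Fin d → ℝ)}
    {D : Fin d → Measure (Fin d → ℝ)} (h : ∀ r, (D (r - 1)).bind (stepKernel ρ r) = D r)
    (r k : ℕ) :
    (D (Fin.ofNat d r)).bind (stepsKernel ρ (r + 1) k) = D (Fin.ofNat d (r + k)) := by
  induction k with
  | zero => simp [stepsKernel]
  | succ k ih =>
    rw [stepsKernel, ← Measure.comp_assoc, ih, ← h (Fin.ofNat d (r + (k + 1)))]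
    rw [← add_assoc r k 1, ofNat_succ_sub_one, show r + 1 + k = r + k + 1 by ring]

/-! ### The walk as a product of stochastic matrices, and `ℓ¹`-contraction. -/

section Deterministic

variable {d : ℕ}

theorem updateRow_one_mem_rowStochastic (i : Fin d) {row : Fin d → ℝ}
    (h : row ∈ stdSimplex ℝ (Fin d)) :
    Matrix.updateRow 1 i row ∈ Matrix.rowStochastic ℝ (Fin d) := by
  refine ⟨fun a b => ?_, ?_⟩
  · rw [Matrix.updateRow_apply, Matrix.one_apply]
    split_ifs
    exacts [h.1 b, zero_le_one, le_rfl]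
  · ext a
    by_cases ha : a = i
    · subst ha
      simpa [Matrix.mulVec, dotProduct] using h.2
    · simp [Matrix.mulVec, dotProduct, Matrix.updateRow_apply, ha, Matrix.one_apply]

theorem sum_vecMul_eq {N : Matrix (Fin d) (Fin d) ℝ} (hN : N ∈ Matrix.rowStochastic ℝ (Fin d))
    (x : Fin d → ℝ) : ∑ j, (x ᵥ* N) j = ∑ j, x j := by
  have h : (x ᵥ* N) ⬝ᵥ 1 = x ⬝ᵥ 1 := by rw [← Matrix.dotProduct_mulVec, hN.2]
  simpa [dotProduct] using h

theorem vecMul_mem_stdSimplex {N : Matrix (Fin d) (Fin d) ℝ}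
    (hN : N ∈ Matrix.rowStochastic ℝ (Fin d)) {x : Fin d → ℝ} (hx : x ∈ stdSimplex ℝ (Fin d)) :
    x ᵥ* N ∈ stdSimplex ℝ (Fin d) :=
  ⟨fun j => by
    rw [Matrix.vecMul, dotProduct]
    exact Finset.sum_nonneg fun i _ => mul_nonneg (hx.1 i) (hN.1 i j),
    (sum_vecMul_eq hN x).trans hx.2⟩

variable [NeZero d]

/-- The matrix that maps the position of the walk at time `0` to its position at time `k`, when
the `(t, i)`-th row used is `R (t, i)`. -/
def stepsMatrix (R : ℕ × Fin d → Fin d → ℝ) : ℕ → Matrix (Fin d) (Fin d) ℝ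
  | 0 => 1
  | k + 1 => stepsMatrix R k * Matrix.updateRow 1 (Fin.ofNat d k) (R (k / d, Fin.ofNat d k))

theorem walk_eq_vecMul (X : ℕ → Matrix (Fin d) (Fin d) ℝ) (x : Fin d → ℝ) (k : ℕ) :
    walk X 0 x k = x ᵥ* stepsMatrix (fun p => X p.1 p.2) k := by
  induction k with
  | zero => simp [walk, stepsMatrix]
  | succ k ih =>
    rw [walk_succ, zero_add, ← vecMul_rowMatrix, ih, stepsMatrix, ← Matrix.vecMul_vecMul]
    rfl

theorem stepsMatrix_mem_rowStochastic {R : ℕ × Fin d → Fin d → ℝ}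
    (hR : ∀ p, R p ∈ stdSimplex ℝ (Fin d)) (k : ℕ) :
    stepsMatrix R k ∈ Matrix.rowStochastic ℝ (Fin d) := by
  induction k with
  | zero => exact one_mem _
  | succ k ih => exact mul_mem ih (updateRow_one_mem_rowStochastic _ (hR _))

theorem continuous_stepsMatrix (k : ℕ) :
    Continuous fun R : ℕ × Fin d → Fin d → ℝ => stepsMatrix R k := by
  induction k with
  | zero => exact continuous_const
  | succ k ih =>
    exact ih.matrix_mul (continuous_const.matrix_updateRow _ (continuous_apply _))

theorem stepsMatrix_mul_add (X : ℕ → Matrix (Fin d) (Fin d) ℝ) (t j : ℕ) (hj : j ≤ d) :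
    stepsMatrix (fun p => X p.1 p.2) (t * d + j) = stepsMatrix (fun p => X p.1 p.2) (t * d) *
      ((List.ofFn fun r => rowMatrix r (X t)).take j).prod := by
  induction j with
  | zero => simp
  | succ j ih =>
    have hj' : j < d := hj
    have h1 : (t * d + j) / d = t := by
      rw [mul_comm, Nat.mul_add_div (by omega), Nat.div_eq_of_lt hj', add_zero]
    have h2 : Fin.ofNat d (t * d + j) = ⟨j, hj'⟩ := by
      ext
      simp [Nat.mod_eq_of_lt hj']
    rw [List.prod_take_succ _ _ (by simpa using hj'), ← mul_assoc, ← ih hj'.le, ← add_assoc,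
      stepsMatrix, h1, h2]
    simp [rowMatrix]

theorem stepsMatrix_mul (X : ℕ → Matrix (Fin d) (Fin d) ℝ) (m : ℕ) :
    stepsMatrix (fun p => X p.1 p.2) (m * d) =
      (List.ofFn fun t : Fin m => rowProduct (X t)).prod := by
  induction m with
  | zero => simp [stepsMatrix]
  | succ m ih =>
    have h : ((List.ofFn fun r => rowMatrix r (X m)).take d).prod = rowProduct (X m) := by
      rw [List.take_of_length_le (by simp)]
      rfl
    rw [Nat.succ_mul, stepsMatrix_mul_add X m d le_rfl, ih, h, List.ofFn_succ']
    simp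

/-- A stochastic matrix whose entries are at least `δ` contracts the `ℓ¹`-distance of probability
vectors. -/
theorem sum_abs_vecMul_sub_le {N : Matrix (Fin d) (Fin d) ℝ}
    (hN : N ∈ Matrix.rowStochastic ℝ (Fin d)) {δ : ℝ} (hδ : 0 ≤ δ) (hNδ : ∀ i j, δ ≤ N i j)
    {x y : Fin d → ℝ} (hx : x ∈ stdSimplex ℝ (Fin d)) (hy : y ∈ stdSimplex ℝ (Fin d)) :
    ∑ j, |(x ᵥ* N) j - (y ᵥ* N) j| ≤ (1 - δ) * ∑ i, |x i - y i| := by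
  have hz : ∑ i, (x i - y i) = 0 := by rw [Finset.sum_sub_distrib, hx.2, hy.2, sub_self]
  have hrow : ∀ i, ∑ j, N i j = 1 := fun i => by
    simpa [Matrix.mulVec, dotProduct] using congrFun hN.2 i
  -- Subtracting `δ` from every entry changes nothing, because the differences `x i - y i` sum to
  -- zero, and the remaining weights are nonnegative.
  have h1 : ∀ j, |(x ᵥ* N) j - (y ᵥ* N) j| ≤ ∑ i, |x i - y i| * (N i j - δ) := by
    intro j
    have : (x ᵥ* N) j - (y ᵥ* N) j = ∑ i, (x i - y i) * (N i j - δ) := by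
      simp only [mul_sub, Finset.sum_sub_distrib, ← Finset.sum_mul, hz]
      simp [Matrix.vecMul, dotProduct, sub_mul]
    rw [this]
    refine (Finset.abs_sum_le_sum_abs _ _).trans (Finset.sum_le_sum fun i _ => ?_)
    rw [abs_mul, abs_of_nonneg (sub_nonneg.2 (hNδ i j))]
  have hd : (1 : ℝ) ≤ d := by exact_mod_cast NeZero.one_le
  calc ∑ j, |(x ᵥ* N) j - (y ᵥ* N) j| ≤ ∑ j, ∑ i, |x i - y i| * (N i j - δ) :=
        Finset.sum_le_sum fun j _ => h1 j
    _ = (1 - d * δ) * ∑ i, |x i - y i| := by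
        rw [Finset.sum_comm, Finset.mul_sum]
        refine Finset.sum_congr rfl fun i _ => ?_
        rw [← Finset.mul_sum, Finset.sum_sub_distrib, hrow i]
        simp [mul_comm]
    _ ≤ (1 - δ) * ∑ i, |x i - y i| := by
        refine mul_le_mul_of_nonneg_right ?_ (Finset.sum_nonneg fun i _ => abs_nonneg _)
        nlinarith

end Deterministic

/-! ### From [C2] to rows in the supports of the row laws. -/

section Positivity

variable {d : ℕ} {Ω : Type*} [MeasurableSpace Ω] {μ : Measure Ω}
  [IsProbabilityMeasure μ] {X : Ω → Matrix (Fin d) (Fin d) ℝ}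

theorem continuous_rowProduct :
    Continuous (rowProduct : Matrix (Fin d) (Fin d) ℝ → Matrix (Fin d) (Fin d) ℝ) := by
  have h : ∀ r : Fin d, Continuous fun X : Matrix (Fin d) (Fin d) ℝ => rowMatrix r X :=
    fun r => continuous_const.matrix_updateRow r (continuous_apply r)
  have h2 := continuous_list_prod (f := fun (r : Fin d) (X : Matrix (Fin d) (Fin d) ℝ) =>
    rowMatrix r X) (List.finRange d) fun r _ => h r
  unfold rowProduct
  simp only [List.ofFn_eq_map]
  exact h2

/-- Rows in the supports of the laws of the rows of `X` can be found for which a product of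
`m` of the matrices `T_1 ⋯ T_d` is positive. -/
theorem EventuallyPositive.exists_support [NeZero d] (hXm : Measurable X)
    (hpos : EventuallyPositive (μ.map fun ω => rowProduct (X ω))) :
    ∃ (m : ℕ) (Y : ℕ → Matrix (Fin d) (Fin d) ℝ),
      (∀ t i, Y t i ∈ (μ.map fun ω => X ω i).support) ∧
        ∀ i j, 0 < stepsMatrix (fun p => Y p.1 p.2) (m * d) i j := by
  obtain ⟨m, hm, hpos⟩ := hpos
  have hbor : BorelSpace (Matrix (Fin d) (Fin d) ℝ) :=
    inferInstanceAs (BorelSpace (Fin d → Fin d → ℝ))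
  have hsc : SecondCountableTopology (Matrix (Fin d) (Fin d) ℝ) :=
    inferInstanceAs (SecondCountableTopology (Fin d → Fin d → ℝ))
  have hS : MeasurableSet {Y : Fin m → Matrix (Fin d) (Fin d) ℝ |
      ∀ i j, 0 < (List.ofFn Y).reverse.prod i j} := by
    have hc : Continuous fun Y : Fin m → Matrix (Fin d) (Fin d) ℝ => (List.ofFn Y).reverse.prod := by
      have := continuous_list_prod
        (f := fun (t : Fin m) (Y : Fin m → Matrix (Fin d) (Fin d) ℝ) => Y t)
        (List.finRange m).reverse fun t _ => continuous_apply t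
      simpa [List.ofFn_eq_map] using this
    simp only [Set.ofPred_forall]
    exact (isOpen_iInter_of_finite fun i => isOpen_iInter_of_finite fun j =>
      isOpen_lt continuous_const (hc.matrix_elem i j)).measurableSet
  have hf : Measurable fun ω => rowProduct (X ω) := continuous_rowProduct.measurable.comp hXm
  have hprob := Measure.isProbabilityMeasure_map (μ := μ) hf.aemeasurable
  have hW : Measurable fun (w : Fin m → Ω) i => rowProduct (X (w i)) :=
    measurable_pi_iff.2 fun t => hf.comp (measurable_pi_apply t)
  -- The i.i.d. products are realized on `Ω ^ m`, which gives access to the rows behind them.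
  rw [← Measure.pi_map_pi (μ := fun _ : Fin m => μ) (f := fun _ ω => rowProduct (X ω))
    fun _ => hf.aemeasurable] at hpos
  replace hpos := hpos.trans_eq (Measure.map_apply hW hS)
  have hsupp : ∀ᵐ ω ∂μ, ∀ i, X ω i ∈ (μ.map fun ω => X ω i).support := by
    refine ae_all_iff.2 fun i => ?_
    have hXi : Measurable fun ω => X ω i :=
      (measurable_pi_apply (X := fun _ : Fin d => Fin d → ℝ) i).comp hXm
    exact ae_of_ae_map hXi.aemeasurable Measure.support_mem_ae
  have hsupp' : ∀ᵐ w ∂Measure.pi fun _ : Fin m => μ, ∀ t i,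
      X (w t) i ∈ (μ.map fun ω => X ω i).support :=
    ae_all_iff.2 fun t => (measurePreserving_eval (fun _ : Fin m => μ) t).quasiMeasurePreserving.ae
      hsupp
  obtain ⟨w, hw, hws⟩ := ((frequently_ae_mem_iff.2 hpos.ne').and_eventually hsupp').exists
  -- [C2] multiplies in decreasing order of time and the walk in increasing order, hence `Fin.rev`.
  -- Beyond `m` any sample serves: only membership in the supports is needed there.
  refine ⟨m, fun t => X (w (if h : t < m then Fin.rev ⟨t, h⟩ else ⟨0, hm⟩)),
    fun t i => hws _ i, fun i j => ?_⟩
  have hrev : (List.ofFn fun t : Fin m => rowProduct (X (w t))).reverse =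
      List.ofFn fun t : Fin m => rowProduct
        (X (w (if h : (t : ℕ) < m then Fin.rev ⟨t, h⟩ else ⟨0, hm⟩))) := by
    refine List.ext_getElem (by simp) fun n h1 h2 => ?_
    have hn : n < m := by simpa using h2
    simp only [List.getElem_reverse, List.getElem_ofFn, List.length_ofFn, hn, dite_true]
    congr 3
    ext
    simp [Fin.rev]
    omega
  have h := (stepsMatrix_mul (fun t => X (w (if h : t < m then Fin.rev ⟨t, h⟩ else ⟨0, hm⟩)))
    m).trans (congrArg List.prod hrev.symm)
  exact (hw i j).trans_eq (congrFun (congrFun h i) j).symm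

end Positivity

/-! ### Uniqueness of the stationary law for contracting kernels. -/

section Contraction

variable {d : ℕ} {E : Type*} [NormedAddCommGroup E]

/-- `f` is `L`-Lipschitz on the simplex for the `ℓ¹`-distance. -/
def LipschitzOnSimplex (L : ℝ) (f : (Fin d → ℝ) → E) : Prop :=
  ∀ x ∈ stdSimplex ℝ (Fin d), ∀ y ∈ stdSimplex ℝ (Fin d), ‖f x - f y‖ ≤ L * ∑ i, |x i - y i|

theorem sum_abs_sub_le_two {x y : Fin d → ℝ} (hx : x ∈ stdSimplex ℝ (Fin d))
    (hy : y ∈ stdSimplex ℝ (Fin d)) : ∑ i, |x i - y i| ≤ 2 := by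
  calc ∑ i, |x i - y i| ≤ ∑ i, (x i + y i) := Finset.sum_le_sum fun i _ => by
        have := hx.1 i
        have := hy.1 i
        rw [abs_le]
        constructor <;> linarith
    _ = 2 := by rw [Finset.sum_add_distrib, hx.2, hy.2]; norm_num

theorem integral_bind_kernel {α β : Type*} [MeasurableSpace α] [MeasurableSpace β]
    [NormedSpace ℝ E] (π : Measure α) [IsFiniteMeasure π] (κ : Kernel α β) [IsMarkovKernel κ]
    {f : β → E} (hf : Integrable f (π.bind κ)) :
    ∫ y, f y ∂π.bind κ = ∫ x, ∫ y, f y ∂κ x ∂π := by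
  have h := Kernel.integral_comp (κ := Kernel.const Unit π) (η := κ) (a := ()) (f := f)
  rw [Kernel.comp_const, Kernel.const_apply] at h
  exact h hf

variable [NormedSpace ℝ E]

theorem LipschitzOnSimplex.norm_integral_sub_le [CompleteSpace E] {L : ℝ} (hL : 0 ≤ L)
    {f : (Fin d → ℝ) → E} (hf : LipschitzOnSimplex L f) {π : Measure (Fin d → ℝ)}
    [IsProbabilityMeasure π]
    (hπ : π (stdSimplex ℝ (Fin d))ᶜ = 0) (hfi : Integrable f π) {x : Fin d → ℝ}
    (hx : x ∈ stdSimplex ℝ (Fin d)) : ‖∫ y, f y ∂π - f x‖ ≤ 2 * L := by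
  have h : ∫ y, f y ∂π - f x = ∫ y, (f y - f x) ∂π := by
    rw [integral_sub hfi (integrable_const _)]
    simp
  have hae : ∀ᵐ y ∂π, y ∈ stdSimplex ℝ (Fin d) := hπ
  rw [h]
  refine (norm_integral_le_of_norm_le_const (C := 2 * L) ?_).trans_eq (by simp)
  filter_upwards [hae] with y hy
  refine (hf y hy x hx).trans ?_
  rw [mul_comm 2]
  exact mul_le_mul_of_nonneg_left (sum_abs_sub_le_two hy hx) hL

/-- Under stationarity `f` may be replaced by its average under `κ`, which multiplies the Lipschitz
constant by `c` and keeps the bound `1`. Iterating drives the constant to `0`, and on the simplex,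
of `ℓ¹`-diameter at most `2`, it controls the difference of the two integrals. -/
theorem integral_eq_of_contraction [CompleteSpace E] [SecondCountableTopology E]
    [MeasurableSpace E] [BorelSpace E]
    {κ : Kernel (Fin d → ℝ) (Fin d → ℝ)} [IsMarkovKernel κ]
    {c : ℝ} (hc0 : 0 ≤ c) (hc1 : c < 1)
    (hκ : ∀ (L : ℝ) (f : (Fin d → ℝ) → E), 0 ≤ L → Measurable f → (∀ x, ‖f x‖ ≤ 1) →
      LipschitzOnSimplex L f → LipschitzOnSimplex (c * L) fun x => ∫ y, f y ∂κ x)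
    {π π' : Measure (Fin d → ℝ)} [IsProbabilityMeasure π] [IsProbabilityMeasure π']
    (hπ : π (stdSimplex ℝ (Fin d))ᶜ = 0) (hπ' : π' (stdSimplex ℝ (Fin d))ᶜ = 0)
    (hi : κ.Invariant π) (hi' : κ.Invariant π') {L : ℝ} (hL : 0 ≤ L) {f : (Fin d → ℝ) → E}
    (hfm : Measurable f) (hf1 : ∀ x, ‖f x‖ ≤ 1) (hf : LipschitzOnSimplex L f) :
    ∫ x, f x ∂π = ∫ x, f x ∂π' := by
  obtain ⟨x, hx⟩ : (stdSimplex ℝ (Fin d)).Nonempty := by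
    by_contra hne
    rw [Set.not_nonempty_iff_eq_empty] at hne
    simp [hne] at hπ
  have key : ∀ (n : ℕ) (L : ℝ), 0 ≤ L → ∀ f : (Fin d → ℝ) → E, Measurable f → (∀ x, ‖f x‖ ≤ 1) →
      LipschitzOnSimplex L f → ‖∫ x, f x ∂π - ∫ x, f x ∂π'‖ ≤ 4 * L * c ^ n := by
    intro n
    induction n with
    | zero =>
      intro L hL f hfm hf1 hf
      have hfi : ∀ (ν : Measure (Fin d → ℝ)) [IsProbabilityMeasure ν], Integrable f ν :=
        fun ν _ => Integrable.of_bound hfm.aestronglyMeasurable 1 (.of_forall hf1)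
      have h1 := hf.norm_integral_sub_le hL hπ (hfi π) hx
      have h2 := hf.norm_integral_sub_le hL hπ' (hfi π') hx
      have h3 := norm_sub_le (∫ x, f x ∂π - f x) (∫ x, f x ∂π' - f x)
      rw [sub_sub_sub_cancel_right] at h3
      simp only [pow_zero, mul_one]
      linarith
    | succ n ih =>
      intro L hL f hfm hf1 hf
      have hfi : ∀ (ν : Measure (Fin d → ℝ)) [IsProbabilityMeasure ν], Integrable f ν :=
        fun ν _ => Integrable.of_bound hfm.aestronglyMeasurable 1 (.of_forall hf1)
      have hinv : ∀ (ν : Measure (Fin d → ℝ)) [IsProbabilityMeasure ν], κ.Invariant ν →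
          ∫ x, f x ∂ν = ∫ x, ∫ y, f y ∂κ x ∂ν := by
        intro ν _ hν
        have hbind : ν.bind κ = ν := hν
        have h := integral_bind_kernel ν κ (f := f) (by rw [hbind]; exact hfi ν)
        rwa [hbind] at h
      have h := ih (c * L) (mul_nonneg hc0 hL) (fun x => ∫ y, f y ∂κ x)
        (hfm.stronglyMeasurable.integral_kernel (κ := κ)).measurable
        (fun x => (norm_integral_le_of_norm_le_const (.of_forall hf1)).trans_eq (by simp))
        (hκ L f hL hfm hf1 hf)
      rw [hinv π hi, hinv π' hi']
      refine h.trans_eq ?_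
      ring
  have hlim : Filter.Tendsto (fun n : ℕ => 4 * L * c ^ n) Filter.atTop (nhds 0) := by
    simpa using (tendsto_pow_atTop_nhds_zero_of_lt_one hc0 hc1).const_mul (4 * L)
  have h0 := ge_of_tendsto' hlim fun n => key n L hL f hfm hf1 hf
  exact sub_eq_zero.1 (norm_le_zero_iff.1 h0)

/-- Uses `|exp(iθ) - 1| ≤ |θ|` and the bound of the sup norm by the `ℓ¹` norm. These are the test
functions of the characteristic function. -/
theorem lipschitzOnSimplex_cexp (l : StrongDual ℝ (Fin d → ℝ)) :
    LipschitzOnSimplex ‖l‖ fun x => Complex.exp (l x * Complex.I) := by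
  intro x _ y _
  have h1 : Complex.exp (l x * Complex.I) - Complex.exp (l y * Complex.I) =
      Complex.exp (l y * Complex.I) * (Complex.exp (Complex.I * ((l x - l y : ℝ) : ℂ)) - 1) := by
    rw [mul_sub, ← Complex.exp_add, mul_one]
    congr 2
    push_cast
    ring
  rw [h1, norm_mul, Complex.norm_exp_ofReal_mul_I, one_mul]
  refine Real.norm_exp_I_mul_ofReal_sub_one_le.trans ?_
  rw [← map_sub]
  refine (l.le_opNorm _).trans (mul_le_mul_of_nonneg_left ?_ (norm_nonneg _))
  refine (pi_norm_le_iff_of_nonneg (Finset.sum_nonneg fun i _ => abs_nonneg _)).2 fun i => ?_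
  exact Finset.single_le_sum (f := fun i => |x i - y i|) (fun i _ => abs_nonneg _)
    (Finset.mem_univ i)

/-- A kernel that contracts the Lipschitz constants on the simplex has at most one stationary
law there. -/
theorem IsStationaryLaw.eq_of_contraction
    {κ : Kernel (Fin d → ℝ) (Fin d → ℝ)} [IsMarkovKernel κ]
    {c : ℝ} (hc0 : 0 ≤ c) (hc1 : c < 1)
    (hκ : ∀ (L : ℝ) (f : (Fin d → ℝ) → ℂ), 0 ≤ L → Measurable f → (∀ x, ‖f x‖ ≤ 1) →
      LipschitzOnSimplex L f → LipschitzOnSimplex (c * L) fun x => ∫ y, f y ∂κ x)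
    {π π' : Measure (Fin d → ℝ)} (hπ : IsStationaryLaw κ π) (hπ' : IsStationaryLaw κ π') :
    π = π' := by
  have := hπ.1
  have := hπ'.1
  refine Measure.ext_of_charFunDual (funext fun l => ?_)
  rw [charFunDual_apply, charFunDual_apply]
  refine integral_eq_of_contraction hc0 hc1 hκ hπ.2.1 hπ'.2.1 hπ.2.2 hπ'.2.2 (norm_nonneg l)
    (by fun_prop) (fun x => ?_) (lipschitzOnSimplex_cexp l)
  rw [Complex.norm_exp_ofReal_mul_I]

end Contraction

/-! ### Uniqueness of the stationary law of the walk. -/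

section Uniqueness

variable {d : ℕ} {Ω : Type*} [MeasurableSpace Ω] {P : Measure Ω}
  {Xs : ℕ → Ω → Matrix (Fin d) (Fin d) ℝ} {ρ : Fin d → Measure (Fin d → ℝ)}

theorem ae_row_mem_stdSimplex (hXs : ∀ t, Measurable (Xs t))
    (hlaw : ∀ t i, P.map (fun ω => Xs t ω i) = ρ i) (hρ : ∀ i, ρ i (stdSimplex ℝ (Fin d))ᶜ = 0) :
    ∀ᵐ ω ∂P, ∀ p : ℕ × Fin d, Xs p.1 ω p.2 ∈ stdSimplex ℝ (Fin d) := by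
  refine ae_all_iff.2 fun p => ?_
  have h : ∀ᵐ x ∂P.map fun ω => Xs p.1 ω p.2, x ∈ stdSimplex ℝ (Fin d) := by
    rw [hlaw]
    exact hρ p.2
  exact ae_of_ae_map (measurable_row hXs p.1 p.2).aemeasurable h

theorem redistribute_mem_stdSimplex {i : Fin d} {row x : Fin d → ℝ}
    (hrow : row ∈ stdSimplex ℝ (Fin d)) (hx : x ∈ stdSimplex ℝ (Fin d)) :
    redistribute i row x ∈ stdSimplex ℝ (Fin d) := by
  refine ⟨fun j => ?_, (sum_redistribute i hrow.2 x).trans hx.2⟩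
  have h := mul_nonneg (hx.1 i) (hrow.1 j)
  have h' := hx.1 j
  unfold redistribute
  split_ifs <;> positivity

variable [NeZero d]

/-- If rows in the supports of the row laws give a positive product, then with positive
probability the entries of the random product are bounded away from `0`. -/
theorem exists_pos_measure_le_stepsMatrix (hXs : ∀ t, Measurable (Xs t))
    (hlaw : ∀ t i, P.map (fun ω => Xs t ω i) = ρ i)
    (hind : iIndepFun (fun (p : ℕ × Fin d) ω => Xs p.1 ω p.2) P)
    {Y : ℕ × Fin d → Fin d → ℝ} (hY : ∀ p, Y p ∈ (ρ p.2).support) {k : ℕ}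
    (hpos : ∀ i j, 0 < stepsMatrix Y k i j) :
    ∃ (δ : ℝ) (B : Set Ω), 0 < δ ∧ δ ≤ 1 ∧ MeasurableSet B ∧ 0 < P B ∧
      ∀ ω ∈ B, ∀ i j, δ ≤ stepsMatrix (fun p => Xs p.1 ω p.2) k i j := by
  obtain ⟨⟨i₀, j₀⟩, hmin⟩ := Finite.exists_min fun p : Fin d × Fin d => stepsMatrix Y k p.1 p.2
  set δ := min (stepsMatrix Y k i₀ j₀ / 2) 1 with hδ
  have hδpos : 0 < δ := lt_min (half_pos (hpos i₀ j₀)) one_pos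
  have hopen : IsOpen {R : ℕ × Fin d → Fin d → ℝ | ∀ i j, δ < stepsMatrix R k i j} := by
    simp only [Set.ofPred_forall]
    exact isOpen_iInter_of_finite fun i => isOpen_iInter_of_finite fun j =>
      isOpen_lt continuous_const ((continuous_stepsMatrix k).matrix_elem i j)
  have hYmem : Y ∈ {R : ℕ × Fin d → Fin d → ℝ | ∀ i j, δ < stepsMatrix R k i j} := fun i j =>
    (min_le_left _ _).trans_lt ((half_lt_self (hpos i₀ j₀)).trans_le (hmin (i, j)))
  obtain ⟨I, u, hu, hsub⟩ := isOpen_pi_iff.1 hopen Y hYmem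
  -- A basic neighbourhood of `Y` restricts finitely many rows, so by independence its probability
  -- is a finite product of positive factors.
  refine ⟨δ, ⋂ p ∈ I, (fun ω => Xs p.1 ω p.2) ⁻¹' u p, hδpos, min_le_right _ _,
    Finset.measurableSet_biInter _ fun p hp => measurable_row hXs p.1 p.2 (hu p hp).1.measurableSet,
    ?_, fun ω hω i j => ?_⟩
  · rw [hind.measure_inter_preimage_eq_mul I fun p hp => (hu p hp).1.measurableSet]
    refine pos_iff_ne_zero.2 (Finset.prod_ne_zero_iff.2 fun p hp => ?_)
    rw [← Measure.map_apply (measurable_row hXs p.1 p.2) (hu p hp).1.measurableSet, hlaw]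
    exact ((Measure.mem_support_iff_forall _).1 (hY p) _
      ((hu p hp).1.mem_nhds (hu p hp).2)).ne'
  · refine (hsub (a := fun p => Xs p.1 ω p.2) (fun p hp => ?_) i j).le
    exact Set.mem_iInter₂.1 hω p hp

/-- Positivity, and with it the contraction, is available only over `m` periods. -/
theorem invariant_stepsKernel_mul {π : Measure (Fin d → ℝ)}
    (h : (stepsKernel ρ 0 d).Invariant π) (m : ℕ) : (stepsKernel ρ 0 (m * d)).Invariant π := by
  induction m with
  | zero => simp [stepsKernel, Kernel.Invariant]
  | succ m ih =>
    have h' := stepsKernel_add_mul ρ m 0 d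
    rw [Nat.succ_mul, stepsKernel_add, zero_add, ← add_zero (m * d), h', add_zero]
    exact h.comp ih

variable [IsProbabilityMeasure P] [∀ i, IsProbabilityMeasure (ρ i)]

theorem bind_stepsKernel_compl_stdSimplex (hρ : ∀ i, ρ i (stdSimplex ℝ (Fin d))ᶜ = 0)
    {π : Measure (Fin d → ℝ)} (hπ : π (stdSimplex ℝ (Fin d))ᶜ = 0) (s k : ℕ) :
    (π.bind (stepsKernel ρ s k)) (stdSimplex ℝ (Fin d))ᶜ = 0 := by
  have hS : MeasurableSet (stdSimplex ℝ (Fin d))ᶜ := measurableSet_stdSimplex.compl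
  induction k with
  | zero => simpa [stepsKernel] using hπ
  | succ k ih =>
    rw [stepsKernel, ← Measure.comp_assoc, Measure.bind_apply hS (Kernel.aemeasurable _)]
    refine lintegral_eq_zero_of_ae_eq_zero ?_
    have hae : ∀ᵐ x ∂π.bind (stepsKernel ρ s k), x ∈ stdSimplex ℝ (Fin d) := ih
    filter_upwards [hae] with x hx
    have hm : Measurable fun row => redistribute (Fin.ofNat d (s + k)) row x :=
      (measurable_redistribute _).comp measurable_prodMk_left
    rw [stepKernel_apply, Measure.map_apply hm hS]
    exact measure_mono_null (fun row hr hrow => hr (redistribute_mem_stdSimplex hrow hx)) (hρ _)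

/-- Couple the walks from `x` and `y` by using the same rows: their distance shrinks by the factor
`1 - δ` on the event `B` and does not grow off it, almost surely. Averaging gives `c = 1 - δ *
P(B)`. -/
theorem exists_lipschitz_contraction (hXs : ∀ t, Measurable (Xs t))
    (hlaw : ∀ t i, P.map (fun ω => Xs t ω i) = ρ i)
    (hind : iIndepFun (fun (p : ℕ × Fin d) ω => Xs p.1 ω p.2) P)
    (hρ : ∀ i, ρ i (stdSimplex ℝ (Fin d))ᶜ = 0)
    {Y : ℕ × Fin d → Fin d → ℝ} (hY : ∀ p, Y p ∈ (ρ p.2).support) {k : ℕ}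
    (hpos : ∀ i j, 0 < stepsMatrix Y k i j) :
    ∃ c : ℝ, 0 ≤ c ∧ c < 1 ∧ ∀ (L : ℝ) (f : (Fin d → ℝ) → ℂ), 0 ≤ L → Measurable f →
      (∀ x, ‖f x‖ ≤ 1) → LipschitzOnSimplex L f →
        LipschitzOnSimplex (c * L) fun x => ∫ y, f y ∂stepsKernel ρ 0 k x := by
  obtain ⟨δ, B, hδ, hδ1, hB, hPB, hle⟩ := exists_pos_measure_le_stepsMatrix hXs hlaw hind hY hpos
  have hPB' : 0 < P.real B := ENNReal.toReal_pos hPB.ne' (measure_ne_top _ _)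
  have hPB1 : P.real B ≤ 1 := measureReal_le_one
  refine ⟨1 - δ * P.real B, by nlinarith, by nlinarith [mul_pos hδ hPB'], ?_⟩
  intro L f hL hfm hf1 hf x hx y hy
  have hw : ∀ z, Measurable fun ω => walk (fun n => Xs n ω) 0 z k := fun z =>
    (measurable_past_walk Xs 0 z k).mono (past_le hXs _) le_rfl
  have hint : ∀ z, ∫ v, f v ∂stepsKernel ρ 0 k z =
      ∫ ω, f (walk (fun n => Xs n ω) 0 z k) ∂P := fun z => by
    rw [← map_walk hXs hlaw hind,
      integral_map (hw z).aemeasurable hfm.aestronglyMeasurable]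
  have hfi : ∀ z, Integrable (fun ω => f (walk (fun n => Xs n ω) 0 z k)) P := fun z =>
    Integrable.of_bound (hfm.comp (hw z)).aestronglyMeasurable 1 (.of_forall fun _ => hf1 _)
  simp only
  rw [hint, hint, ← integral_sub (hfi x) (hfi y)]
  set D := ∑ i, |x i - y i|
  have hgi : Integrable (fun ω => L * D * (1 - B.indicator (fun _ => δ) ω)) P :=
    ((integrable_const 1).sub ((integrable_const δ).indicator hB)).const_mul _
  refine (norm_integral_le_of_norm_le hgi ?_).trans_eq ?_
  · filter_upwards [ae_row_mem_stdSimplex hXs hlaw hρ] with ω hω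
    have hN := stepsMatrix_mem_rowStochastic hω k
    rw [walk_eq_vecMul, walk_eq_vecMul, mul_assoc]
    refine (hf _ (vecMul_mem_stdSimplex hN hx) _ (vecMul_mem_stdSimplex hN hy)).trans
      (mul_le_mul_of_nonneg_left ?_ hL)
    rw [mul_comm]
    by_cases hωB : ω ∈ B
    · rw [Set.indicator_of_mem hωB]
      exact sum_abs_vecMul_sub_le hN hδ.le (hle ω hωB) hx hy
    · rw [Set.indicator_of_notMem hωB]
      exact sum_abs_vecMul_sub_le hN le_rfl hN.1 hx hy
  · rw [integral_const_mul, integral_sub (integrable_const 1) ((integrable_const δ).indicator hB),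
      integral_indicator_const δ hB]
    simp
    ring

/-- The stationary law at one phase is determined by the one at the start of a period. -/
theorem IsStationaryLaw.eq_of_phase_zero (hρ : ∀ i, ρ i (stdSimplex ℝ (Fin d))ᶜ = 0)
    (h0 : ∀ π π', IsStationaryLaw (stepsKernel ρ 0 d) π →
      IsStationaryLaw (stepsKernel ρ 0 d) π' → π = π')
    {s : ℕ} (hs : s ≤ d) {π π' : Measure (Fin d → ℝ)}
    (hπ : IsStationaryLaw (stepsKernel ρ s d) π) (hπ' : IsStationaryLaw (stepsKernel ρ s d) π') :
    π = π' := by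
  have hper : ∀ k, stepsKernel ρ d k = stepsKernel ρ 0 k := fun k => by
    simpa using stepsKernel_add_mul ρ 1 0 k
  have hsd : s + (d - s) = d := by omega
  -- The `d - s` moves that finish the period intertwine the period kernels at phases `s` and `0`:
  -- `2d - s` moves from time `s` can be split in two ways.
  have hshift : ∀ ν, IsStationaryLaw (stepsKernel ρ s d) ν →
      IsStationaryLaw (stepsKernel ρ 0 d) (ν.bind (stepsKernel ρ s (d - s))) := by
    rintro ν ⟨hν1, hν2, hν3⟩
    refine ⟨inferInstance, bind_stepsKernel_compl_stdSimplex hρ hν2 _ _, ?_⟩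
    have hν3' : ν.bind (stepsKernel ρ s d) = ν := hν3
    have h1 := stepsKernel_add ρ s (d - s) d
    rw [hsd, hper, add_comm (d - s) d, stepsKernel_add,
      show s + d = 1 * d + s by ring, stepsKernel_add_mul] at h1
    rw [Kernel.Invariant, Measure.comp_assoc, ← h1, ← Measure.comp_assoc, hν3']
  -- The next `s` moves complete a full period from phase `s`, so they recover `ν` and the shift is
  -- injective on stationary laws.
  have hback : ∀ ν, IsStationaryLaw (stepsKernel ρ s d) ν →
      (ν.bind (stepsKernel ρ s (d - s))).bind (stepsKernel ρ 0 s) = ν := by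
    rintro ν ⟨hν1, hν2, hν3⟩
    have h1 := stepsKernel_add ρ s (d - s) s
    rw [hsd, hper, show d - s + s = d by omega] at h1
    rw [Measure.comp_assoc, ← h1]
    exact hν3
  rw [← hback π hπ, h0 _ _ (hshift π hπ) (hshift π' hπ'), hback π' hπ']

end Uniqueness

end PollingNetwork

theorem theorem7 {d : ℕ} [NeZero d]
    -- the random stochastic matrix `X` and the Gamma matrix `V`
    {Ω : Type*} [MeasurableSpace Ω] (μ : Measure Ω) [IsProbabilityMeasure μ]
    (X V : Ω → Matrix (Fin d) (Fin d) ℝ) (hXm : Measurable X) (hVm : Measurable V)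
    (hX : ∀ᵐ ω ∂μ, X ω ∈ Matrix.rowStochastic ℝ (Fin d))
    (hpos : PollingNetwork.EventuallyPositive (μ.map fun ω => PollingNetwork.rowProduct (X ω)))
    -- the Gamma parameters
    (A : Matrix (Fin d) (Fin d) ℝ) (hB : ∀ r j, 0 < PollingNetwork.cyclicSum A r j)
    (hV : μ.map V = PollingNetwork.gammaLaw (PollingNetwork.cyclicSum A))
    (hVX : IndepFun V X μ)
    (hVT : ∀ r : Fin d, IdentDistrib (fun ω => V ω r)
      (fun ω => V ω (r - 1) ᵥ* PollingNetwork.rowMatrix r (X ω)) μ μ)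
    -- the driving matrices `X(0), X(1), …`: their rows are independent, and row `r` of each of
    -- them is distributed as row `r` of `X`
    {Ω' : Type*} [MeasurableSpace Ω'] (P : Measure Ω') [IsProbabilityMeasure P]
    (Xs : ℕ → Ω' → Matrix (Fin d) (Fin d) ℝ) (hXsm : ∀ t, Measurable (Xs t))
    (hXs : ∀ (t : ℕ) (r : Fin d),
      IdentDistrib (fun ω => Xs t ω r) (fun ω => X ω r) P μ)
    (hind : iIndepFun (fun (p : ℕ × Fin d) ω => Xs p.1 ω p.2) P)
    -- the non-random starting point
    (b : Fin d → ℝ) (hb : b ∈ stdSimplex ℝ (Fin d))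
    -- the number of the observed phase; it starts at `0`, so the observed times are `td + r + 1`
    (r : Fin d) :
    PollingNetwork.IsHomogeneousMarkovChain P
        (PollingNetwork.periodKernel (P.map fun ω t => Xs t ω) (r + 1))
        (fun t ω => PollingNetwork.walk (fun n => Xs n ω) 0 b (t * d + (r + 1))) ∧
      ∀ π : Measure (Fin d → ℝ),
        PollingNetwork.IsStationaryLaw
            (PollingNetwork.periodKernel (P.map fun ω t => Xs t ω) (r + 1)) π ↔
          π = PollingNetwork.dirichlet (PollingNetwork.cyclicSum A r) := by
  open PollingNetwork in
  have hrowm : ∀ i, Measurable fun ω => X ω i := fun i =>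
    (measurable_pi_apply (X := fun _ : Fin d => Fin d → ℝ) i).comp hXm
  have hρp : ∀ i, IsProbabilityMeasure (μ.map fun ω => X ω i) :=
    fun i => Measure.isProbabilityMeasure_map (hrowm i).aemeasurable
  have hlaw : ∀ t i, P.map (fun ω => Xs t ω i) = μ.map fun ω => X ω i := fun t i => (hXs t i).map_eq
  have hρ : ∀ i, (μ.map fun ω => X ω i) (stdSimplex ℝ (Fin d))ᶜ = 0 := fun i => by
    rw [Measure.map_apply (hrowm i) measurableSet_stdSimplex.compl]
    have h : ∀ᵐ ω ∂μ, X ω i ∈ stdSimplex ℝ (Fin d) := by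
      filter_upwards [hX] with ω hω
      exact ⟨hω.1 i, by simpa [Matrix.mulVec, dotProduct] using congrFun hω.2 i⟩
    exact h
  rw [periodKernel_eq_stepsKernel hXsm hlaw hind]
  refine ⟨isHomogeneousMarkovChain_walk hXsm hlaw hind _ b, ?_⟩
  have hD : IsStationaryLaw (stepsKernel (fun i => μ.map fun ω => X ω i) (r + 1) d)
      (dirichlet (cyclicSum A r)) := by
    refine ⟨isProbabilityMeasure_dirichlet (hB r), dirichlet_compl_stdSimplex _, ?_⟩
    have h := bind_stepsKernel (D := fun i => dirichlet (cyclicSum A i))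
      (bind_stepKernel_dirichlet hXm hVm hX hB hV hVX hVT) (r : ℕ) d
    have h1 : Fin.ofNat d r = r := by ext; simp
    have h2 : Fin.ofNat d (r + d) = r := by ext; simp [Nat.mod_eq_of_lt r.2]
    rw [h1, h2] at h
    exact h
  obtain ⟨m, Y, hY, hYpos⟩ := hpos.exists_support hXm
  obtain ⟨c, hc0, hc1, hc⟩ := exists_lipschitz_contraction hXsm hlaw hind hρ
    (Y := fun p => Y p.1 p.2) (fun p => hY p.1 p.2) hYpos
  refine fun π => ⟨fun hπ => ?_, fun hπ => hπ ▸ hD⟩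
  refine IsStationaryLaw.eq_of_phase_zero hρ (fun ν ν' hν hν' => ?_) (Nat.succ_le_of_lt r.2) hπ hD
  -- The contraction concerns `m * d` moves from phase `0`, for which both laws are stationary as
  -- well.
  exact IsStationaryLaw.eq_of_contraction hc0 hc1 hc
    ⟨hν.1, hν.2.1, invariant_stepsKernel_mul hν.2.2 m⟩
    ⟨hν'.1, hν'.2.1, invariant_stepsKernel_mul hν'.2.2 m⟩
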